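/- Let $k$ be a field, let $n\ge 2$ be an integer, and put $S=k[u]/(u^n)$ and $m=\lfloor n/2\rfloor$. Let $D_{sg}(S)$ be the Verdier quotient of the bounded derived category of finitely generated $S$-modules by the subcategory of bounded complexes of finitely generated projective modules, and let $V_j$ denote the image in $D_{sg}(S)$ of the module $k[u]/(u^j)$, $0\le j\le n$. For an object $G$ of a triangulated category $\mathcal T$, let $\langle G\rangle_0$ be the full subcategory of direct summands of finite direct sums of shifts of $G$, and let $\langle G\rangle_{t}$ consist of the direct summands of objects $B$ that fit in a distinguished triangle $B_1\to B\to B_2\to B_1[1]$ with $B_1\in\langle G\rangle_{t-1}$ and $B_2\in\langle G\rangle_0$. The object $G$ is a generator if $\bigcup_t\langle G\rangle_t=\mathcal T$; its generation time is the least $t$ with $\langle G\rangle_t=\mathcal T$ (and $\infty$ if there is none); the Orlov spectrum of $\mathcal T$ is the set of all finite generation times of objects of $\mathcal T$. A set $I$ of integers has a gap of length $s$ if, for some $a$, the integers of $I$ in $[a,a+s+1]$ are exactly $a$ and $a+s+1$. Then the following hold. 1. The Orlov spectrum of $D_{sg}(S)$ is $$\left\{\left\lceil \frac{m}{s}\right\rceil-1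 \;:\; s\in\mathbb Z,\ s\ge 1\right\}.$$ 2. Let $G$ be a generator of $D_{sg}(S)$, and let $\delta(0)$ be the largest $j\in\{0,\dots,m\}$ with $V_j\in\langle G\rangle_0$. Then $\delta(0)\ge 1$, and the generation time of $G$ is $0$ if $\langle G\rangle_0=D_{sg}(S)$, and is $\max\{\lceil m/\delta(0)\rceil-1,\,1\}$ otherwise. 3. The Orlov spectrum of $D_{sg}(S)$ has a gap of length at least $1$ if and only if $n\ge 8$. -/

import Mathlib

open CategoryTheory Limits Pretriangulated Triangulated
open scoped Polynomial ZeroObject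

universe w u

namespace OrlovSpectrum

noncomputable section

/-! ### Generation time and the Orlov spectrum of a triangulated category -/

section Generation

variable {T : Type*} [Category T] [HasZeroObject T] [HasShift T ℤ] [Preadditive T]
  [∀ n : ℤ, (shiftFunctor T n).Additive] [Pretriangulated T]

/-- `⟨E⟩_t`: the objects obtained from `E` by shifts, finite direct sums, direct summands and at
most `t` cones.  `level E 0` is the closure of `E` under shifts, finite sums and summands, and
`level E (t + 1)` is the closure under summands of the extensions between `level E 0` and
`level E t` (such extensions are automatically closed under shifts and finite sums, and the
order of the two factors is irrelevant, by the octahedral axiom). -/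
abbrev level (E : T) (t : ℕ) : ObjectProperty T :=
  (ObjectProperty.singleton E).triangEnvelopeIter t

/-- `E` is a generator if every object lies in `⟨E⟩_t` for some `t`. -/
def IsGenerator (E : T) : Prop := ∀ X : T, ∃ t : ℕ, level E t X

/-- The least `t` such that `⟨E⟩_t` is the whole category, and `⊤` if there is none. -/
def generationTime (E : T) : ℕ∞ := ⨅ (t : ℕ) (_ : level E t = ⊤), (t : ℕ∞)

variable (T) in
/-- The set of all finite generation times of objects of `T`. -/
def orlovSpectrum : Set ℕ := {t | ∃ G : T, generationTime G = (t : ℕ∞)}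

end Generation

/-- `I` has a gap of length `s` if some integer interval `[a, a + s + 1]` meets `I` exactly in its
two endpoints. -/
def HasGap (I : Set ℕ) (s : ℕ) : Prop :=
  ∃ a : ℕ, Set.Icc a (a + s + 1) ∩ I = {a, a + s + 1}

/-! ### The category of singularities -/

theorem projective_iff {S : Type u} [CommRing S] [IsNoetherianRing S]
    (M : FGModuleCat.{u} S) : Projective M ↔ Module.Projective S M := by
  constructor
  · intro hM
    obtain ⟨n, f, hf⟩ := Module.Finite.exists_fin' S M
    let F : FGModuleCat.{u} S := FGModuleCat.of S (Fin n → S)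
    let g : F ⟶ M := FGModuleCat.ofHom (W := M) f
    have : Epi g := ConcreteCategory.epi_of_surjective g hf
    let s := Projective.factorThru (𝟙 M) g
    have hs : s ≫ g = 𝟙 M := Projective.factorThru_comp _ _
    refine Module.Projective.of_split s.hom.hom f ?_
    have := congrArg (fun t : M ⟶ M => t.hom.hom) hs
    exact this
  · intro hM
    refine ⟨fun {E X} f e _ => ?_⟩
    have he : Epi ((forget₂ (FGModuleCat.{u} S) (ModuleCat.{u} S)).map e) := inferInstance
    rw [ModuleCat.epi_iff_surjective] at he
    obtain ⟨g, hg⟩ := Module.projective_lifting_property e.hom.hom f.hom.hom he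
    exact ⟨FGModuleCat.ofHom g, FGModuleCat.hom_ext hg⟩

section Singularities

variable (S : Type u) [CommRing S] [IsNoetherianRing S]

/-- Bounded complexes of finitely generated projective `S`-modules. -/
def IsBoundedProjective (K : CochainComplex (FGModuleCat.{u} S) ℤ) : Prop :=
  (∃ a : ℤ, K.IsStrictlyGE a) ∧ (∃ b : ℤ, K.IsStrictlyLE b) ∧
    ∀ i : ℤ, Module.Projective S (K.X i)

variable [HasDerivedCategory.{w} (FGModuleCat.{u} S)]

/-- The objects of the derived category of `mod S` that are isomorphic to a bounded complex of
finitely generated projective modules. -/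
def perfectComplexes : ObjectProperty (DerivedCategory (FGModuleCat.{u} S)) :=
  fun X => ∃ K : CochainComplex (FGModuleCat.{u} S) ℤ,
    IsBoundedProjective S K ∧ Nonempty (X ≅ DerivedCategory.Q.obj K)

instance : (perfectComplexes S).IsClosedUnderIsomorphisms where
  of_iso e := by
    rintro ⟨K, hK, ⟨i⟩⟩
    exact ⟨K, hK, ⟨e.symm ≪≫ i⟩⟩

instance : (perfectComplexes S).ContainsZero where
  exists_zero := by
    refine ⟨DerivedCategory.Q.obj 0, Functor.map_isZero _ (isZero_zero _), 0,
      ⟨⟨0, inferInstance⟩, ⟨0, inferInstance⟩, fun i => ?_⟩, ⟨Iso.refl _⟩⟩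
    rw [← projective_iff]
    exact Projective.of_iso ((HomologicalComplex.eval _ _ i).mapZeroObject).symm inferInstance

instance : (perfectComplexes S).IsStableUnderShift ℤ where
  isStableUnderShiftBy n :=
    { le_shift := by
        rintro X ⟨K, ⟨⟨a, _⟩, ⟨b, _⟩, hP⟩, ⟨e⟩⟩
        exact ⟨K⟦n⟧, ⟨⟨a - n, K.isStrictlyGE_shift a n _ (by lia)⟩,
          ⟨b - n, K.isStrictlyLE_shift b n _ (by lia)⟩, fun i => hP (i + n)⟩,
          ⟨(shiftFunctor _ n).mapIso e ≪≫ (DerivedCategory.Q.commShiftIso n).symm.app K⟩⟩ }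

instance : (perfectComplexes S).IsTriangulatedClosed₃ where
  ext₃' T hT := by
    rintro ⟨K, ⟨⟨a, _⟩, ⟨b, _⟩, hK⟩, ⟨e⟩⟩ ⟨L, ⟨⟨a', _⟩, ⟨b', _⟩, hL⟩, ⟨e'⟩⟩
    simp only [← projective_iff] at hK hL
    have := CochainComplex.isKProjective_of_projective K b
    let i := DerivedCategory.quotientCompQhIso (FGModuleCat.{u} S)
    obtain ⟨g, hg⟩ := (CochainComplex.IsKProjective.Qh_map_bijective K
      ((HomotopyCategory.quotient _ _).obj L)).surjective
      (i.hom.app K ≫ e.inv ≫ T.mor₁ ≫ e'.hom ≫ i.inv.app L)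
    obtain ⟨f, rfl⟩ := (HomotopyCategory.quotient _ _).map_surjective g
    have hf : DerivedCategory.Q.map f = e.inv ≫ T.mor₁ ≫ e'.hom := by
      rw [← cancel_epi (i.hom.app K)]
      have := DerivedCategory.quotientCompQhIso_hom_naturality f
      rw [← this, hg]
      simp [i]
    refine ⟨DerivedCategory.Q.obj (CochainComplex.mappingCone f),
      ⟨_, ⟨⟨min (a - 1) a', CochainComplex.isStrictlyGE_mappingCone f a a' _ (by simp) (by simp)⟩,
        ⟨max (b - 1) b', ?_⟩, fun n => ?_⟩, ⟨Iso.refl _⟩⟩,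
      ⟨Triangle.π₃.mapIso (isoTriangleOfIso₁₂ T _ hT
        (DerivedCategory.mappingCone_triangle_distinguished f) e e' ?_)⟩⟩
    · rw [CochainComplex.isStrictlyLE_iff]
      intro j hj
      simp only [CochainComplex.mappingCone.isZero_X_iff]
      exact ⟨K.isZero_of_isStrictlyLE b _ (by lia), L.isZero_of_isStrictlyLE b' _ (by lia)⟩
    · rw [← projective_iff]
      exact Projective.of_iso
        (HomologicalComplex.homotopyCofiber.XIsoBiprod f n (n + 1) rfl).symm inferInstance
    · change T.mor₁ ≫ e'.hom = e.hom ≫ DerivedCategory.Q.map f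
      rw [hf, Iso.hom_inv_id_assoc]

instance : (perfectComplexes S).IsTriangulated where
  toIsTriangulatedClosed₂ := .of_isTriangulatedClosed₃

/-- The bounded derived category of finitely generated `S`-modules: the full subcategory of the
derived category of `mod S` on the complexes with bounded cohomology. -/
abbrev Db := DerivedCategory.Bounded (FGModuleCat.{u} S)

/-- The bounded complexes of finitely generated projective modules, inside `Db S`. -/
def perf : ObjectProperty (Db.{w} S) :=
  (perfectComplexes S).inverseImage DerivedCategory.Bounded.ι

instance : (perf S).IsTriangulated := by
  unfold perf
  infer_instance

/-- The category of singularities: the Verdier quotient of `Db S` by `perf S`, that is, the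
localization at the morphisms whose cone is in `perf S`. -/
abbrev Dsg := (perf.{w} S).trW.Localization

/-- A finitely generated module, seen in degree `0` of the bounded derived category. -/
def moduleToDb (M : FGModuleCat.{u} S) : Db.{w} S :=
  ⟨(DerivedCategory.singleFunctor (FGModuleCat.{u} S) 0).obj M,
    ⟨0, inferInstance⟩, ⟨0, inferInstance⟩⟩

/-- The image of a finitely generated module in the category of singularities. -/
def moduleToDsg (M : FGModuleCat.{u} S) : Dsg.{w} S :=
  (perf.{w} S).trW.Q.obj (moduleToDb S M)

end Singularities

/-! ### The ring `k[u]/(u ^ n)` -/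

section TruncatedPolynomials

variable (k : Type u) [Field k] (n : ℕ)

/-- The ring `k[u]/(u ^ n)`. -/
abbrev TruncPoly : Type u := k[X] ⧸ Ideal.span {(Polynomial.X : k[X]) ^ n}

/-- The class of the variable `u` in `k[u]/(u ^ n)`. -/
def TruncPoly.u : TruncPoly k n := Ideal.Quotient.mk _ Polynomial.X

/-- For `j ≤ n`, the image `V_j` in the category of singularities of the `k[u]/(u ^ n)`-module
`k[u]/(u ^ j)`, which is the quotient of `k[u]/(u ^ n)` by the ideal `(u ^ j)`. -/
def V [HasDerivedCategory.{w} (FGModuleCat.{u} (TruncPoly k n))] (j : ℕ) :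
    Dsg.{w} (TruncPoly k n) :=
  moduleToDsg (TruncPoly k n)
    (FGModuleCat.of (TruncPoly k n) (TruncPoly k n ⧸ Ideal.span {TruncPoly.u k n ^ j}))

end TruncatedPolynomials

end

end OrlovSpectrum

open OrlovSpectrum

/-!
Write `S = k[u]/(u ^ n)`, `m = n / 2`. The category `D_sg(S)` is `S`-linear, and generation times in
it are computed by playing two bounds against each other.

*Objects.* Killing the top cohomology of a complex by a projective module, one degree at a time,
shows that every object of `D_sg(S)` is a shift of a module (`exists_iso_shift_moduleToDsg`). By
the structure theorem over `k[u]` every module is a sum of the `k[u]/(u ^ j)`, `j ≤ n`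
(`exists_equiv_pi_uniserial`). For `a + b = i + c` with `c ≤ a, b ≤ i ≤ n` there is an exact
sequence `0 ⟶ k[u]/u^a ⟶ k[u]/u^i × k[u]/u^c ⟶ k[u]/u^b ⟶ 0` (`extension_exact`). With `i = n`,
`c = 0` it yields `V_j[1] ≅ V_{n-j}`, so that up to shift only the `V_j` with `j ≤ m` matter.

*Upper bound.* If `V_s` lies in `⟨G⟩_0`, the same extensions with `a = s` show that `V_i` lies in
`⟨G⟩_t` for all `i ≤ (t + 1) * s`, provided `1 ≤ t` (`level_V`). Hence `⟨G⟩_t` is everything once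
`m ≤ (t + 1) * s`. The level `t = 0` is exceptional, whence the maximum with `1` in the formula.

*Lower bound.* If `δ` is the largest `j ≤ m` with `V_j` in `⟨G⟩_0`, then `u ^ δ` acts as zero
on `G`, so `u ^ (δ * (t + 1))` acts as zero on `⟨G⟩_t` (`level_le_killedBy`). But `u ^ (m - 1)` does
not act as zero on `V_m`: the ring `S` is self-injective (`baer`), so a morphism of modules that
vanishes in `D_sg(S)` factors through a projective module (`exists_factor_of_map_eq_zero`), which
multiplication by `u ^ (m - 1)` on `k[u]/(u ^ m)` does not (`not_factor_through_projective`). So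
`⟨G⟩_t` can only be everything if `m ≤ (t + 1) * δ`.

Everything that the argument uses about `D_sg(S)` is recorded in `IsUniserialSystem`. The statement
about gaps is arithmetic (`exists_hasGap_iff`): the two largest generation times are `m - 1` and
`⌈m / 2⌉ - 1`.
-/

namespace OrlovSpectrum

/-! ### Closure properties of the levels `⟨E⟩_t` -/

section Closure

variable {T : Type*} [Category T] [HasZeroObject T] [HasShift T ℤ] [Preadditive T]
  [∀ n : ℤ, (shiftFunctor T n).Additive] [Pretriangulated T]

theorem isClosedUnderFiniteProducts_of_biprod (P : ObjectProperty T) [P.IsClosedUnderIsomorphisms]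
    [P.ContainsZero] (h : ∀ X Y, P X → P Y → P (X ⊞ Y)) : P.IsClosedUnderFiniteProducts := by
  have : P.IsClosedUnderBinaryProducts :=
    { limitsOfShape_le := by
        rintro X ⟨p⟩
        refine P.prop_of_iso ?_ (h _ _ (p.prop_diag_obj (.mk .left)) (p.prop_diag_obj (.mk .right)))
        exact IsLimit.conePointUniqueUpToIso (BinaryBiproduct.isLimit _ _)
          ((IsLimit.postcomposeHomEquiv (diagramIsoPair p.diag) _).2 p.isLimit) }
  exact .mk'

theorem prop_biproduct (P : ObjectProperty T) [P.IsClosedUnderFiniteProducts] {d : ℕ}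
    {f : Fin d → T} (h : ∀ i, P (f i)) : P (⨁ f) :=
  P.prop_of_isLimit (biproduct.isLimit f) (by rintro ⟨i⟩; exact h i)

/-- A finite product of distinguished triangles is distinguished. -/
instance (P Q : ObjectProperty T) [P.IsClosedUnderFiniteProducts]
    [Q.IsClosedUnderFiniteProducts] : (P.extensionProduct Q).IsClosedUnderFiniteProducts where
  isClosedUnderLimitsOfShape J _ :=
    { limitsOfShape_le := by
        rintro X ⟨p⟩
        choose Y Z f g h hT hY hZ using fun j : J => p.prop_diag_obj ⟨j⟩
        refine ObjectProperty.prop_of_iso _ ?_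
          (⟨_, _, _, _, _, productTriangle_distinguished _ hT, P.prop_product hY,
            Q.prop_product hZ⟩ : P.extensionProduct Q (∏ᶜ fun j => p.diag.obj ⟨j⟩))
        exact IsLimit.conePointUniqueUpToIso (limit.isLimit _)
          ((IsLimit.postcomposeHomEquiv Discrete.natIsoFunctor _).2 p.isLimit) }

instance (P : ObjectProperty T) [P.IsClosedUnderBinaryProducts] [P.Nonempty] :
    P.retractClosure.IsClosedUnderFiniteProducts := by
  refine isClosedUnderFiniteProducts_of_biprod _ ?_
  rintro X Y ⟨X', hX, ⟨r⟩⟩ ⟨Y', hY, ⟨s⟩⟩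
  refine ⟨X' ⊞ Y', ?_, ⟨⟨biprod.map r.i s.i, biprod.map r.r s.r, ?_⟩⟩⟩
  · exact P.prop_of_isLimit (BinaryBiproduct.isLimit X' Y') (by rintro ⟨_ | _⟩ <;> assumption)
  · ext <;> simp

instance (P : ObjectProperty T) [P.IsClosedUnderFiniteProducts] (t : ℕ) :
    (P.extensionProductIter t).IsClosedUnderFiniteProducts := by
  induction t with
  | zero => assumption
  | succ t ih =>
    rw [ObjectProperty.extensionProductIter_succ]
    infer_instance

instance (E : T) (t : ℕ) : (level E t).IsClosedUnderFiniteProducts := by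
  have : ((ObjectProperty.singleton E).shiftClosure ℤ).binaryProductsClosure.Nonempty :=
    .mono ((ObjectProperty.le_shiftClosure _).trans (ObjectProperty.le_limitsClosure _ _))
  unfold level ObjectProperty.triangEnvelopeIter
  infer_instance

theorem level_self (E : T) (t : ℕ) : level E t E :=
  ObjectProperty.le_triangEnvelopeIter _ t E (by simp)

theorem level_mono (E : T) {s t : ℕ} (h : s ≤ t) : level E s ≤ level E t :=
  ObjectProperty.monotone'_triangEnvelopeIter _ h

theorem level_zero_le {E : T} {P : ObjectProperty T} [P.IsStableUnderRetracts]
    [P.IsClosedUnderFiniteProducts] [P.IsStableUnderShift ℤ] (h : P E) : level E 0 ≤ P := by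
  rw [level, ObjectProperty.triangEnvelopeIter_zero, ObjectProperty.retractClosure_le_iff,
    ObjectProperty.binaryProductsClosure_le_iff, ObjectProperty.shiftClosure_le_iff]
  simpa using h

theorem level_succ_of_distTriang {E X Y Z : T} {t : ℕ} {f : X ⟶ Y} {g : Y ⟶ Z}
    {h : Z ⟶ X⟦(1 : ℤ)⟧} (hT : Triangle.mk f g h ∈ distTriang T) (hX : level E 0 X)
    (hZ : level E t Z) : level E (t + 1) Y := by
  rw [level, ObjectProperty.triangEnvelopeIter_succ]
  refine ObjectProperty.le_retractClosure _ _ ⟨X, Z, f, g, h, hT, ?_, hZ⟩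
  rwa [level, ObjectProperty.triangEnvelopeIter_zero] at hX

theorem generationTime_le_iff {G : T} {t : ℕ} :
    generationTime G ≤ (t : ℕ∞) ↔ level G t = ⊤ := by
  constructor
  · intro h
    by_contra hne
    have : ((t + 1 : ℕ) : ℕ∞) ≤ generationTime G := by
      refine le_iInf₂ fun s hs => ?_
      by_contra hlt
      have hst : s ≤ t := by
        have := not_le.1 hlt
        norm_cast at this
        lia
      exact hne (top_le_iff.1 (hs ▸ level_mono G hst))
    have := this.trans h
    norm_cast at this
    lia
  · exact fun h => iInf₂_le t h

theorem generationTime_eq_iff {G : T} {t : ℕ} :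
    generationTime G = (t : ℕ∞) ↔ level G t = ⊤ ∧ ∀ s < t, level G s ≠ ⊤ := by
  simp only [← generationTime_le_iff, ne_eq, not_le]
  constructor
  · intro h
    exact ⟨h.le, fun s hs => h ▸ by exact_mod_cast hs⟩
  · rintro ⟨h, h'⟩
    refine le_antisymm h ?_
    cases t with
    | zero => simp
    | succ t => exact_mod_cast Order.add_one_le_of_lt (h' t (Nat.lt_succ_self t))

end Closure

/-! ### Annihilators of objects -/

section Annihilator

variable {T : Type*} [Category T] [Preadditive T] {R : Type*} [CommRing R] [Linear R T]

/-- The objects `X` on which the scalar `r` acts as zero. -/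
def killedBy (r : R) : ObjectProperty T := fun X => r • 𝟙 X = 0

theorem killedBy.of_factor {r : R} {X Y : T} (h : killedBy r X) (i : Y ⟶ X) : r • i = 0 := by
  have h : r • 𝟙 X = 0 := h
  rw [← Category.comp_id i, ← Linear.comp_smul, h, comp_zero]

theorem killedBy.of_dvd {r s : R} {X : T} (h : killedBy r X) (hrs : r ∣ s) : killedBy s X := by
  obtain ⟨c, rfl⟩ := hrs
  have h : r • 𝟙 X = 0 := h
  change (r * c) • 𝟙 X = 0
  rw [mul_comm, mul_smul, h, smul_zero]

instance (r : R) : (killedBy r : ObjectProperty T).IsStableUnderRetracts where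
  of_retract {X Y} e h := by
    change r • 𝟙 X = 0
    rw [← e.retract, ← Linear.smul_comp, h.of_factor, zero_comp]

variable [HasZeroObject T] [HasShift T ℤ]
  [∀ n : ℤ, (shiftFunctor T n).Additive] [Pretriangulated T]

instance (r : R) : (killedBy r : ObjectProperty T).ContainsZero where
  exists_zero := ⟨0, isZero_zero _, (isZero_zero T).eq_of_src _ _⟩

instance (r : R) : (killedBy r : ObjectProperty T).IsClosedUnderFiniteProducts := by
  refine isClosedUnderFiniteProducts_of_biprod _ fun X Y hX hY => ?_
  have hX : r • 𝟙 X = 0 := hX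
  have hY : r • 𝟙 Y = 0 := hY
  change r • 𝟙 (X ⊞ Y) = 0
  rw [← biprod.total, smul_add, ← Linear.comp_smul, ← Linear.comp_smul,
    ← Category.id_comp biprod.inl, ← Category.id_comp biprod.inr,
    ← Linear.smul_comp, ← Linear.smul_comp, hX, hY]
  simp

/-- If the outer terms of a distinguished triangle are killed by `r` and by `s`, the middle term
is killed by `r * s`: multiplication by `s` factors through the first term. -/
theorem extensionProduct_killedBy_le (r s : R) :
    (killedBy r : ObjectProperty T).extensionProduct (killedBy s) ≤ killedBy (r * s) := by
  rintro Y ⟨X, Z, f, g, h, hT, hX, hZ⟩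
  obtain ⟨φ, hφ⟩ : ∃ φ : Y ⟶ X, s • 𝟙 Y = φ ≫ f :=
    Triangle.coyoneda_exact₂ _ hT (s • 𝟙 Y) (by
      change (s • 𝟙 Y) ≫ g = 0
      rw [Linear.smul_comp, Category.id_comp, killedBy.of_factor hZ])
  change (r * s) • 𝟙 Y = 0
  rw [mul_smul, hφ, ← Linear.smul_comp, killedBy.of_factor hX, zero_comp]

variable [∀ n : ℤ, (shiftFunctor T n).Linear R]

instance (r : R) : (killedBy r : ObjectProperty T).IsStableUnderShift ℤ where
  isStableUnderShiftBy n :=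
    { le_shift := by
        intro X h
        have h : r • 𝟙 X = 0 := h
        change r • 𝟙 (X⟦n⟧) = 0
        rw [← CategoryTheory.Functor.map_id, ← Functor.map_smul, h, Functor.map_zero] }

/-- The ghost-type bound: each cone multiplies the annihilator by one more factor `r`. -/
theorem level_le_killedBy {r : R} {E : T} (h : killedBy r E) (t : ℕ) :
    level E t ≤ killedBy (r ^ (t + 1)) := by
  induction t with
  | zero => simpa using level_zero_le h
  | succ t ih =>
    rw [level, ObjectProperty.triangEnvelopeIter_succ, ObjectProperty.retractClosure_le_iff,
      pow_succ']
    refine le_trans ?_ (extensionProduct_killedBy_le _ _)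
    have h0 := level_zero_le (P := killedBy r) h
    rw [level, ObjectProperty.triangEnvelopeIter_zero] at h0
    exact (ObjectProperty.monotone_extensionProduct_left _ h0).trans
      (ObjectProperty.monotone_extensionProduct_right _ ih)

end Annihilator

/-! ### Arithmetic of the numbers `⌈m / s⌉ - 1` -/

section Arithmetic

theorem eq_ceil_sub_one_iff {m s t : ℕ} (hs : 1 ≤ s) :
    (t : ℤ) = ⌈(m : ℚ) / (s : ℚ)⌉ - 1 ↔ t * s < m ∧ m ≤ (t + 1) * s := by
  have hs' : (0 : ℚ) < s := by exact_mod_cast hs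
  rw [eq_sub_iff_add_eq, eq_comm, Int.ceil_eq_iff, lt_div_iff₀ hs', div_le_iff₀ hs']
  push_cast
  rw [add_sub_cancel_right]
  exact and_congr (by exact_mod_cast Iff.rfl) (by exact_mod_cast Iff.rfl)

theorem ceil_sub_one_nonneg {m s : ℕ} (hm : 1 ≤ m) (hs : 1 ≤ s) :
    ∃ t : ℕ, (t : ℤ) = ⌈(m : ℚ) / (s : ℚ)⌉ - 1 := by
  have : 0 < ⌈(m : ℚ) / (s : ℚ)⌉ := Int.ceil_pos.2 (by positivity)
  exact ⟨(⌈(m : ℚ) / (s : ℚ)⌉ - 1).toNat, Int.toNat_of_nonneg (by lia)⟩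

/-- The two largest elements of the set are `m - 1`, for `s = 1`, and `⌈m / 2⌉ - 1`, for `s = 2`;
they leave a gap between them as soon as `4 ≤ m`. -/
theorem exists_hasGap_iff {m : ℕ} {I : Set ℕ} (hm : 1 ≤ m)
    (hI : I = {t : ℕ | ∃ s : ℕ, 1 ≤ s ∧ (t : ℤ) = ⌈(m : ℚ) / (s : ℚ)⌉ - 1}) :
    (∃ s : ℕ, 1 ≤ s ∧ HasGap I s) ↔ 4 ≤ m := by
  have hI' : ∀ t, t ∈ I ↔ ∃ s : ℕ, 1 ≤ s ∧ t * s < m ∧ m ≤ (t + 1) * s := fun t => by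
    rw [hI]
    exact exists_congr fun s => and_congr_right fun hs => eq_ceil_sub_one_iff hs
  constructor
  · rintro ⟨s, hs, a, ha⟩
    by_contra hlt
    obtain ⟨-, h⟩ : a + s + 1 ∈ Set.Icc a (a + s + 1) ∩ I := by rw [ha]; simp
    obtain ⟨r, hr, h, -⟩ := (hI' _).1 h
    have h3 : a + s + 1 < m := lt_of_le_of_lt (Nat.le_mul_of_pos_right _ hr) h
    -- only `m = 3`, `a = 0`, `s = 1` is left, and then `1 ∈ I` lies inside the interval
    obtain ⟨rfl, rfl, rfl⟩ : m = 3 ∧ a = 0 ∧ s = 1 := by lia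
    have h1 : 1 ∈ Set.Icc 0 (0 + 1 + 1) ∩ I := ⟨by simp, (hI' 1).2 ⟨2, by simp⟩⟩
    rw [ha] at h1
    simp at h1
  · intro h4
    -- `(m - 1) / 2` is `⌈m / 2⌉ - 1`
    refine ⟨m - 2 - (m - 1) / 2, by lia, (m - 1) / 2, ?_⟩
    rw [show (m - 1) / 2 + (m - 2 - (m - 1) / 2) + 1 = m - 1 by lia]
    ext t
    constructor
    · rintro ⟨⟨h1, h2⟩, h3⟩
      obtain ⟨s, hs, hlt, hle⟩ := (hI' t).1 h3
      rcases hs.eq_or_lt with rfl | hs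
      · exact Or.inr (by simp; lia)
      · have := Nat.mul_le_mul_left t hs
        exact Or.inl (by lia)
    · rintro (rfl | rfl)
      · exact ⟨⟨le_rfl, by lia⟩, (hI' _).2 ⟨2, by lia, by lia, by lia⟩⟩
      · exact ⟨⟨by lia, le_rfl⟩, (hI' _).2 ⟨1, by lia, by lia, by lia⟩⟩

end Arithmetic

/-! ### Generation times determined by a system of uniserial objects -/

section System

variable {T : Type*} [Category T] [HasZeroObject T] [HasShift T ℤ] [Preadditive T]
  [∀ n : ℤ, (shiftFunctor T n).Additive] [Pretriangulated T]
  {R : Type*} [CommRing R] [Linear R T]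

/-- The features of the stable category of `k[u]/(u ^ n)` that determine its generation times:
every object is a shift of a finite sum of objects `V j`, `j ≤ n`, with `V 0` and `V n` zero, the
uniserial modules have their standard extensions, `u ^ j` acts as zero on `V j`, and
`u ^ (n / 2 - 1)` does not act as zero on `V (n / 2)`. -/
structure IsUniserialSystem (u : R) (n : ℕ) (V : ℕ → T) : Prop where
  isZero_bot : IsZero (V 0)
  isZero_top : IsZero (V n)
  exists_distTriang {a b c i : ℕ} : a + b = i + c → c ≤ a → a ≤ i → b ≤ i → i ≤ n →
    ∃ (f : V a ⟶ V i ⊞ V c) (g : V i ⊞ V c ⟶ V b) (h : V b ⟶ (V a)⟦(1 : ℤ)⟧),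
      Triangle.mk f g h ∈ distTriang T
  exists_iso_shift_biproduct (X : T) : ∃ (d : ℕ) (e : Fin d → ℕ) (a : ℤ), (∀ i, e i ≤ n) ∧
    Nonempty (X ≅ (⨁ fun i => V (e i))⟦a⟧)
  killedBy_pow {j : ℕ} : j ≤ n → killedBy (u ^ j) (V j)
  not_killedBy_pow : ¬ killedBy (u ^ (n / 2 - 1)) (V (n / 2))

namespace IsUniserialSystem

variable {u : R} {n : ℕ} {V : ℕ → T}

/-- The extension with middle term `V n ⊞ V 0 = 0` identifies `V (n - j)` with the shift
of `V j`. -/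
theorem nonempty_iso_shift (hV : IsUniserialSystem u n V)
    {j : ℕ} (hj : j ≤ n) : Nonempty (V (n - j) ≅ (V j)⟦(1 : ℤ)⟧) := by
  obtain ⟨f, g, h, hT⟩ := hV.exists_distTriang (a := j) (b := n - j) (c := 0) (i := n)
    (by lia) (by lia) (by lia) (by lia) le_rfl
  have h0 : IsZero (V n ⊞ V 0) := by
    rw [biprod_isZero_iff]
    exact ⟨hV.isZero_top, hV.isZero_bot⟩
  have : IsIso h := (Triangle.isZero₂_iff_isIso₃ _ hT).1 h0
  exact ⟨asIso h⟩

/-- A property stable under shifts does not distinguish `V j` from `V (n - j)`. -/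
theorem prop_sub (hV : IsUniserialSystem u n V)
    {P : ObjectProperty T} [P.IsClosedUnderIsomorphisms] [P.IsStableUnderShift ℤ]
    {j : ℕ} (hj : j ≤ n) (h : P (V j)) : P (V (n - j)) := by
  obtain ⟨e⟩ := hV.nonempty_iso_shift hj
  exact P.prop_of_iso e.symm (P.le_shift 1 _ h)

theorem eq_top_of_forall (hV : IsUniserialSystem u n V)
    {P : ObjectProperty T} [P.IsClosedUnderIsomorphisms]
    [P.IsStableUnderShift ℤ] [P.IsClosedUnderFiniteProducts]
    (h : ∀ j ≤ n / 2, P (V j)) : P = ⊤ := by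
  rw [eq_top_iff]
  rintro X -
  obtain ⟨d, e, a, he, ⟨i⟩⟩ := hV.exists_iso_shift_biproduct X
  refine P.prop_of_iso i.symm (P.le_shift a _ (prop_biproduct P fun k => ?_))
  by_cases hk : e k ≤ n / 2
  · exact h _ hk
  · rw [← Nat.sub_sub_self (he k)]
    exact hV.prop_sub (Nat.sub_le _ _) (h _ (by lia))

/-- If `V δ` is the largest `V j`, `j ≤ n / 2`, in `⟨G⟩_0`, then `u ^ δ` kills `G`: every summand
`V j` of `G` has `j ≤ δ` or `n - j ≤ δ`, and is killed by the same power of `u` as `V (n - j)`. -/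
theorem killedBy_of_level (hV : IsUniserialSystem u n V)
    [∀ n : ℤ, (shiftFunctor T n).Linear R] {G : T} {δ : ℕ}
    (hδ : ∀ j ≤ n / 2, level G 0 (V j) → j ≤ δ) : killedBy (u ^ δ) G := by
  obtain ⟨d, e, a, he, ⟨i⟩⟩ := hV.exists_iso_shift_biproduct G
  have hG : level G 0 (⨁ fun k => V (e k)) :=
    (ObjectProperty.prop_shift_iff_of_isStableUnderShift _ _ a).1
      (ObjectProperty.prop_of_iso _ i (level_self G 0))
  refine ObjectProperty.prop_of_iso _ i.symm
    ((killedBy (T := T) (u ^ δ)).le_shift a _ (prop_biproduct _ fun k => ?_))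
  have hk := ObjectProperty.IsStableUnderRetracts.of_biproduct _ _ hG k
  by_cases hkn : e k ≤ n / 2
  · exact (hV.killedBy_pow (he k)).of_dvd (pow_dvd_pow u (hδ _ hkn hk))
  · have h1 := hδ (n - e k) (by lia) (hV.prop_sub (he k) hk)
    rw [← Nat.sub_sub_self (he k)]
    exact hV.prop_sub (Nat.sub_le _ _)
      ((hV.killedBy_pow (Nat.sub_le _ _)).of_dvd (pow_dvd_pow u h1))

/-- Each further cone with `V s` raises by `s` the largest index `i` with `V i` reached. -/
theorem level_V (hV : IsUniserialSystem u n V)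
    {G : T} {s t : ℕ} (hs : level G 0 (V s)) (hsn : 2 * s ≤ n) (ht : 1 ≤ t) {i : ℕ}
    (hi : i ≤ (t + 1) * s) (hin : i ≤ n) : level G t (V i) := by
  induction t, ht using Nat.le_induction generalizing i with
  | base =>
    -- `V s` extended by itself gives `V (s + c) ⊞ V (s - c)`
    rcases le_total s i with h | h
    · obtain ⟨f, g, p, hT⟩ := hV.exists_distTriang (a := s) (b := s) (c := 2 * s - i) (i := i)
        (by lia) (by lia) (by lia) (by lia) hin
      exact ObjectProperty.IsStableUnderRetracts.of_biprod_left _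
        (level_succ_of_distTriang hT hs hs)
    · obtain ⟨f, g, p, hT⟩ := hV.exists_distTriang (a := s) (b := s) (c := i) (i := 2 * s - i)
        (by lia) (by lia) (by lia) (by lia) (by lia)
      exact ObjectProperty.IsStableUnderRetracts.of_biprod_right _
        (level_succ_of_distTriang hT hs hs)
  | succ t ht ih =>
    rcases le_total i ((t + 1) * s) with h | h
    · exact level_mono G (Nat.le_succ t) _ (ih h hin)
    · have h1 : s ≤ (t + 1) * s := Nat.le_mul_of_pos_left _ (by lia)
      have h2 : (t + 1 + 1) * s = (t + 1) * s + s := by ring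
      obtain ⟨f, g, p, hT⟩ := hV.exists_distTriang (a := s) (b := (t + 1) * s)
        (c := s + (t + 1) * s - i) (i := i) (by lia) (by lia) (by lia) h hin
      exact ObjectProperty.IsStableUnderRetracts.of_biprod_left _
        (level_succ_of_distTriang hT hs (ih le_rfl (h.trans hin)))

theorem level_eq_top (hV : IsUniserialSystem u n V)
    {G : T} {s t : ℕ} (hs : level G 0 (V s)) (hsn : s ≤ n / 2) (ht : 1 ≤ t)
    (h : n / 2 ≤ (t + 1) * s) : level G t = ⊤ :=
  hV.eq_top_of_forall fun _ hj => hV.level_V hs (by lia) ht (hj.trans h) (by lia)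

/-- If `u ^ s` kills `G`, then `u ^ ((t + 1) * s)` kills `⟨G⟩_t`, whereas `V (n / 2)` is not killed
by `u ^ (n / 2 - 1)`. -/
theorem le_of_level_eq_top (hV : IsUniserialSystem u n V)
    [∀ n : ℤ, (shiftFunctor T n).Linear R] {G : T} {s t : ℕ}
    (hs : killedBy (u ^ s) G) (h : level G t = ⊤) : n / 2 ≤ (t + 1) * s := by
  by_contra hlt
  refine hV.not_killedBy_pow (killedBy.of_dvd (level_le_killedBy hs t _ ?_)
    (by rw [← pow_mul]; exact pow_dvd_pow u (by rw [mul_comm]; lia)))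
  rw [h]
  trivial

/-- The lower bound from the annihilator `u ^ s` and the upper bound from the summand `V s` agree,
except that `t = 0` cannot be reached in the second one. -/
theorem generationTime_eq_of_killedBy (hV : IsUniserialSystem u n V)
    [∀ n : ℤ, (shiftFunctor T n).Linear R] {G : T} {s t : ℕ}
    (hs : level G 0 (V s)) (hsn : s ≤ n / 2) (hk : killedBy (u ^ s) G) (ht : 1 ≤ t)
    (h0 : level G 0 ≠ ⊤) (h1 : n / 2 ≤ (t + 1) * s) (h2 : t = 1 ∨ t * s < n / 2) :
    generationTime G = (t : ℕ∞) := by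
  refine generationTime_eq_iff.2 ⟨hV.level_eq_top hs hsn ht h1, fun r hr hr' => ?_⟩
  rcases h2 with rfl | h2
  · obtain rfl : r = 0 := by lia
    exact h0 hr'
  · exact absurd (hV.le_of_level_eq_top hk hr')
      (not_le.2 ((Nat.mul_le_mul_right s hr).trans_lt h2))

/-- The generation time of a generator is governed by the largest `V δ` that it splits off. -/
theorem exists_isGreatest (hV : IsUniserialSystem u n V)
    [∀ n : ℤ, (shiftFunctor T n).Linear R] (hn : 2 ≤ n) {G : T}
    (hG : IsGenerator G) :
    ∃ δ : ℕ, 1 ≤ δ ∧ IsGreatest {j : ℕ | j ≤ n / 2 ∧ level G 0 (V j)} δ ∧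
      (level G 0 = ⊤ → generationTime G = 0) ∧
      (level G 0 ≠ ⊤ → ∃ t : ℕ, generationTime G = (t : ℕ∞) ∧
        (t : ℤ) = max (⌈((n / 2 : ℕ) : ℚ) / (δ : ℚ)⌉ - 1) 1) := by
  have hz : level G 0 (V 0) := ObjectProperty.prop_of_isZero _ hV.isZero_bot
  obtain ⟨δ, hδ⟩ := BddAbove.exists_isGreatest_of_nonempty
    (S := {j : ℕ | j ≤ n / 2 ∧ level G 0 (V j)}) ⟨n / 2, fun j hj => hj.1⟩ ⟨0, by lia, hz⟩
  have hk : killedBy (u ^ δ) G := hV.killedBy_of_level fun j h1 h2 => hδ.2 ⟨h1, h2⟩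
  have hδ1 : 1 ≤ δ := by
    by_contra h
    obtain rfl : δ = 0 := by lia
    -- otherwise `1 = u ^ 0` kills `G`, hence everything that `G` generates
    obtain ⟨t, ht⟩ := hG (V (n / 2))
    refine hV.not_killedBy_pow (killedBy.of_dvd (level_le_killedBy hk t _ ht) ?_)
    simp
  refine ⟨δ, hδ1, hδ, fun h => generationTime_eq_iff.2 ⟨h, by simp⟩, fun h => ?_⟩
  obtain ⟨t, ht⟩ := ceil_sub_one_nonneg (m := n / 2) (by lia) hδ1
  obtain ⟨h1, h2⟩ := (eq_ceil_sub_one_iff hδ1).1 ht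
  refine ⟨max t 1, ?_, by rw [← ht]; simp⟩
  rcases le_total t 1 with h' | h'
  · rw [max_eq_right h']
    exact hV.generationTime_eq_of_killedBy hδ.1.2 hδ.1.1 hk le_rfl h
      (h2.trans (Nat.mul_le_mul_right δ (by lia))) (Or.inl rfl)
  · rw [max_eq_left h']
    exact hV.generationTime_eq_of_killedBy hδ.1.2 hδ.1.1 hk h' h h2 (Or.inr h1)

theorem exists_generationTime_eq_zero (hV : IsUniserialSystem u n V)
    [∀ n : ℤ, (shiftFunctor T n).Linear R] :
    ∃ G : T, generationTime G = ((0 : ℕ) : ℕ∞) := by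
  refine ⟨⨁ fun j : Fin (n + 1) => V j, generationTime_eq_iff.2 ⟨?_, by simp⟩⟩
  refine hV.eq_top_of_forall fun j hj => ?_
  exact ObjectProperty.IsStableUnderRetracts.of_biproduct _ _ (level_self _ 0)
    (⟨j, by lia⟩ : Fin (n + 1))

theorem orlovSpectrum_eq (hV : IsUniserialSystem u n V)
    [∀ n : ℤ, (shiftFunctor T n).Linear R] (hn : 2 ≤ n) :
    orlovSpectrum T =
      {t : ℕ | ∃ s : ℕ, 1 ≤ s ∧ (t : ℤ) = ⌈((n / 2 : ℕ) : ℚ) / (s : ℚ)⌉ - 1} := by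
  ext t
  constructor
  · rintro ⟨G, hG⟩
    have hgen : IsGenerator G := fun X => ⟨t, by
      rw [(generationTime_eq_iff.1 hG).1]
      trivial⟩
    obtain ⟨δ, hδ1, hδ, h0, h1⟩ := hV.exists_isGreatest hn hgen
    by_cases h : level G 0 = ⊤
    · -- the time `0` is that of `s = n / 2` in the formula
      have : t = 0 := by
        have := hG.symm.trans (h0 h)
        exact_mod_cast this
      subst this
      exact ⟨n / 2, by lia, (eq_ceil_sub_one_iff (by lia)).2 ⟨by lia, by lia⟩⟩
    · obtain ⟨t', ht', ht''⟩ := h1 h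
      have : t = t' := by
        have := hG.symm.trans ht'
        exact_mod_cast this
      subst this
      rcases max_choice (⌈((n / 2 : ℕ) : ℚ) / (δ : ℚ)⌉ - 1) 1 with hm | hm
      · exact ⟨δ, hδ1, ht''.trans hm⟩
      · rw [hm] at ht''
        obtain rfl : t = 1 := by exact_mod_cast ht''
        -- the time `1` is also that of `s = n / 2 - 1`, as `n / 2 = 1` would force `δ = 1`
        have h2 : 2 ≤ n / 2 := by
          by_contra h2
          refine h (hV.eq_top_of_forall fun j hj => ?_)
          obtain rfl : δ = 1 := by have := hδ.1.1; lia
          rcases Nat.le_one_iff_eq_zero_or_eq_one.1 (show j ≤ 1 by lia) with rfl | rfl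
          · exact ObjectProperty.prop_of_isZero _ hV.isZero_bot
          · exact hδ.1.2
        exact ⟨n / 2 - 1, by lia, (eq_ceil_sub_one_iff (by lia)).2 ⟨by lia, by lia⟩⟩
  · rintro ⟨s, hs, hst⟩
    obtain ⟨h1, h2⟩ := (eq_ceil_sub_one_iff hs).1 hst
    rcases Nat.eq_zero_or_pos t with rfl | ht
    · exact hV.exists_generationTime_eq_zero
    · -- for `1 ≤ t`, the object `V s` has generation time `t`
      have hsn : s < n / 2 := lt_of_le_of_lt (Nat.le_mul_of_pos_left _ ht) h1
      have hk := hV.killedBy_pow (j := s) (by lia)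
      exact ⟨V s, hV.generationTime_eq_of_killedBy (level_self _ 0) hsn.le hk ht
        (fun h => by have := hV.le_of_level_eq_top hk h; lia) h2 (Or.inr h1)⟩

end IsUniserialSystem

end System

/-! ### Modules over `k[u]/(u ^ n)` -/

noncomputable section TruncatedAlgebra

variable {k : Type u} [Field k] {n : ℕ}

namespace TruncPoly

local notation "S" => TruncPoly k n
local notation "υ" => TruncPoly.u k n

theorem u_pow_self : υ ^ n = 0 := by
  rw [u, ← map_pow, Ideal.Quotient.eq_zero_iff_mem]
  exact Ideal.mem_span_singleton_self _

theorem mk_eq_zero_iff {p : k[X]} :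
    (Ideal.Quotient.mk (Ideal.span {(Polynomial.X : k[X]) ^ n}) p) = 0 ↔ Polynomial.X ^ n ∣ p := by
  rw [Ideal.Quotient.eq_zero_iff_mem, Ideal.mem_span_singleton]

theorem u_pow_dvd_mk_iff {j : ℕ} (hj : j ≤ n) {p : k[X]} :
    υ ^ j ∣ Ideal.Quotient.mk (Ideal.span {(Polynomial.X : k[X]) ^ n}) p ↔ Polynomial.X ^ j ∣ p := by
  constructor
  · rintro ⟨c, hc⟩
    obtain ⟨q, rfl⟩ := Ideal.Quotient.mk_surjective c
    rw [u, ← map_pow, ← map_mul, ← sub_eq_zero, ← map_sub, mk_eq_zero_iff] at hc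
    exact (dvd_sub_left (dvd_mul_right _ _)).1 ((pow_dvd_pow _ hj).trans hc)
  · rintro ⟨q, rfl⟩
    rw [map_mul, map_pow]
    exact dvd_mul_right _ _

/-- The annihilator of `u ^ d` is generated by `u ^ (n - d)`. -/
theorem u_pow_dvd_of_mul_eq_zero {d : ℕ} (hd : d ≤ n) {x : S} (h : υ ^ d * x = 0) :
    υ ^ (n - d) ∣ x := by
  obtain ⟨p, rfl⟩ := Ideal.Quotient.mk_surjective x
  rw [u, ← map_pow, ← map_mul, mk_eq_zero_iff] at h
  rw [u_pow_dvd_mk_iff (Nat.sub_le _ _)]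
  refine (mul_dvd_mul_iff_left (pow_ne_zero d (Polynomial.X_ne_zero (R := k)))).1 ?_
  rwa [← pow_add, Nat.add_sub_cancel' hd]

theorem u_pow_dvd_u_pow_iff {i j : ℕ} (hj : j ≤ n) : υ ^ j ∣ υ ^ i ↔ j ≤ i := by
  rw [show υ ^ i = Ideal.Quotient.mk _ (Polynomial.X ^ i) from (map_pow _ _ _).symm,
    u_pow_dvd_mk_iff hj]
  exact pow_dvd_pow_iff Polynomial.X_ne_zero Polynomial.not_isUnit_X

/-- The ring `k[u]/(u ^ n)` is self-injective: an ideal is generated by the class of a divisor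
`p` of `u ^ n = p * q`, and a multiple of `p` is exactly what the annihilator of `q` contains. -/
theorem baer : Module.Baer S S := by
  intro I g
  obtain ⟨p, hp⟩ := (IsPrincipalIdealRing.principal
    (I.comap (Ideal.Quotient.mk (Ideal.span {(Polynomial.X : k[X]) ^ n})))).principal
  have hmem : ∀ q : k[X], Ideal.Quotient.mk (Ideal.span {(Polynomial.X : k[X]) ^ n}) q ∈ I ↔ p ∣ q :=
    fun q => by
      rw [← Ideal.mem_comap, hp, Ideal.submodule_span_eq, Ideal.mem_span_singleton]
  have hpI := (hmem p).2 dvd_rfl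
  obtain ⟨q, hq⟩ := (hmem (Polynomial.X ^ n)).1 (by rw [mk_eq_zero_iff.2 dvd_rfl]; exact I.zero_mem)
  obtain ⟨y, hy⟩ := Ideal.Quotient.mk_surjective (g ⟨_, hpI⟩)
  have hp0 : p ≠ 0 := by
    rintro rfl
    exact pow_ne_zero n (Polynomial.X_ne_zero (R := k)) (by rw [hq, zero_mul])
  have hq0 : q ≠ 0 := by
    rintro rfl
    exact pow_ne_zero n (Polynomial.X_ne_zero (R := k)) (by rw [hq, mul_zero])
  have hyq : Polynomial.X ^ n ∣ q * y := by
    rw [← mk_eq_zero_iff, map_mul, hy, ← smul_eq_mul, ← map_smul]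
    convert map_zero g
    rw [Subtype.ext_iff]
    change Ideal.Quotient.mk _ q * Ideal.Quotient.mk _ p = 0
    rw [← map_mul, mul_comm, ← hq, mk_eq_zero_iff]
  obtain ⟨z, rfl⟩ : p ∣ y := by
    rw [hq, mul_comm p q] at hyq
    exact (mul_dvd_mul_iff_left hq0).1 hyq
  refine ⟨LinearMap.toSpanSingleton S S (Ideal.Quotient.mk _ z), fun x hx => ?_⟩
  obtain ⟨x, rfl⟩ := Ideal.Quotient.mk_surjective x
  obtain ⟨r, rfl⟩ := (hmem x).1 hx
  have : (⟨_, hx⟩ : I) = (Ideal.Quotient.mk _ r : S) • ⟨_, hpI⟩ := by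
    rw [Subtype.ext_iff]
    change Ideal.Quotient.mk _ (p * r) = Ideal.Quotient.mk _ r * Ideal.Quotient.mk _ p
    rw [← map_mul, mul_comm]
  rw [this, map_smul, ← hy, LinearMap.toSpanSingleton_apply, smul_eq_mul, smul_eq_mul,
    ← map_mul, ← map_mul]
  congr 1
  ring

variable (k n) in
/-- The uniserial module `k[u]/(u ^ j)` over `k[u]/(u ^ n)`. -/
abbrev Uniserial (j : ℕ) : Type u := S ⧸ Ideal.span {υ ^ j}

local notation "W" => Uniserial k n

theorem uniserial_mk_eq_zero_iff {j : ℕ} {x : S} :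
    (Submodule.Quotient.mk x : W j) = 0 ↔ υ ^ j ∣ x := by
  rw [Submodule.Quotient.mk_eq_zero, Ideal.mem_span_singleton]

theorem u_pow_smul_uniserial {i j : ℕ} (h : j ≤ i) (x : W j) : υ ^ i • x = 0 := by
  obtain ⟨x, rfl⟩ := Submodule.Quotient.mk_surjective _ x
  rw [← Submodule.Quotient.mk_smul, uniserial_mk_eq_zero_iff]
  exact (pow_dvd_pow _ h).mul_right _

/-- Multiplication by `u ^ d`, as a map `k[u]/(u ^ a) ⟶ k[u]/(u ^ b)`; it is well defined because
`b ≤ d + a`. -/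
def mulPow {a b : ℕ} (d : ℕ) (h : b ≤ d + a) : W a →ₗ[S] W b :=
  Submodule.mapQ _ _ (LinearMap.lsmul S S (υ ^ d)) (by
    refine (Submodule.span_singleton_le_iff_mem _ _).2 ?_
    change υ ^ d * υ ^ a ∈ Ideal.span {υ ^ b}
    rw [← pow_add]
    exact Ideal.mem_span_singleton.2 (pow_dvd_pow _ h))

theorem mulPow_mk {a b d : ℕ} (h : b ≤ d + a) (x : S) :
    mulPow d h (Submodule.Quotient.mk x : W a) = Submodule.Quotient.mk (υ ^ d * x) := rfl

/-- The inclusion `x ↦ (u ^ (i - a) * x, x)` of the extension `0 ⟶ W a ⟶ W i × W c ⟶ W b ⟶ 0`, where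
`W j = k[u]/(u ^ j)` and `a + b = i + c`. -/
def extensionInl {a c i : ℕ} (hca : c ≤ a) (hai : a ≤ i) : W a →ₗ[S] W i × W c :=
  (mulPow (i - a) (Nat.sub_add_cancel hai).ge).prod (mulPow 0 (by lia))

/-- The projection `(x, y) ↦ x - u ^ (i - a) * y` of the extension
`0 ⟶ W a ⟶ W i × W c ⟶ W b ⟶ 0`. -/
def extensionSnd {a b c i : ℕ} (h : a + b = i + c) (hbi : b ≤ i) : W i × W c →ₗ[S] W b :=
  (mulPow 0 (by lia)).coprod (-mulPow (i - a) (by lia))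

theorem extensionInl_injective {a c i : ℕ} (hca : c ≤ a) (hai : a ≤ i) (hin : i ≤ n) :
    Function.Injective (extensionInl (k := k) (n := n) hca hai) := by
  rw [← LinearMap.ker_eq_bot, LinearMap.ker_eq_bot']
  intro x hx
  obtain ⟨x, rfl⟩ := Submodule.Quotient.mk_surjective _ x
  have h1 := congrArg Prod.fst hx
  change mulPow (i - a) _ (Submodule.Quotient.mk x) = 0 at h1
  rw [mulPow_mk, uniserial_mk_eq_zero_iff] at h1
  obtain ⟨w, hw⟩ := h1
  rw [uniserial_mk_eq_zero_iff]
  have h2 : υ ^ (i - a) * (x - υ ^ a * w) = 0 := by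
    rw [mul_sub, hw, ← mul_assoc, ← pow_add, Nat.sub_add_cancel hai, sub_self]
  exact (dvd_sub_left (dvd_mul_right _ _)).1
    ((pow_dvd_pow _ (by lia)).trans (u_pow_dvd_of_mul_eq_zero (by lia) h2))

theorem extensionSnd_surjective {a b c i : ℕ} (h : a + b = i + c) (hbi : b ≤ i) :
    Function.Surjective (extensionSnd (k := k) (n := n) h hbi) := by
  intro x
  obtain ⟨x, rfl⟩ := Submodule.Quotient.mk_surjective _ x
  refine ⟨(Submodule.Quotient.mk x, 0), ?_⟩
  rw [extensionSnd, LinearMap.coprod_apply, map_zero, add_zero, mulPow_mk, pow_zero, one_mul]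

theorem extension_exact {a b c i : ℕ} (h : a + b = i + c) (hca : c ≤ a) (hai : a ≤ i)
    (hbi : b ≤ i) : Function.Exact (extensionInl (k := k) (n := n) hca hai) (extensionSnd h hbi) := by
  have key : ∀ x y : S, extensionSnd h hbi
      ((Submodule.Quotient.mk x : W i), (Submodule.Quotient.mk y : W c)) =
        Submodule.Quotient.mk (x - υ ^ (i - a) * y) := fun x y => by
    rw [extensionSnd, LinearMap.coprod_apply, LinearMap.neg_apply, mulPow_mk, mulPow_mk, pow_zero,
      one_mul, ← sub_eq_add_neg, Submodule.Quotient.mk_sub]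
  rintro ⟨x, y⟩
  obtain ⟨x, rfl⟩ := Submodule.Quotient.mk_surjective _ x
  obtain ⟨y, rfl⟩ := Submodule.Quotient.mk_surjective _ y
  rw [key, uniserial_mk_eq_zero_iff]
  constructor
  · rintro ⟨w, hw⟩
    refine ⟨Submodule.Quotient.mk (y + υ ^ c * w), Prod.ext ?_ ?_⟩
    · change Submodule.Quotient.mk (υ ^ (i - a) * (y + υ ^ c * w)) = Submodule.Quotient.mk x
      rw [mul_add, ← mul_assoc, ← pow_add, show i - a + c = b by lia, ← hw]
      congr 1
      ring
    · change Submodule.Quotient.mk (υ ^ 0 * (y + υ ^ c * w)) = Submodule.Quotient.mk y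
      rw [← sub_eq_zero, ← Submodule.Quotient.mk_sub, uniserial_mk_eq_zero_iff]
      exact ⟨w, by ring⟩
  · rintro ⟨z, hz⟩
    obtain ⟨z, rfl⟩ := Submodule.Quotient.mk_surjective _ z
    have h1 : (Submodule.Quotient.mk (υ ^ (i - a) * z) : W i) = Submodule.Quotient.mk x :=
      congrArg Prod.fst hz
    have h2 : (Submodule.Quotient.mk (υ ^ 0 * z) : W c) = Submodule.Quotient.mk y :=
      congrArg Prod.snd hz
    rw [← sub_eq_zero, ← Submodule.Quotient.mk_sub, uniserial_mk_eq_zero_iff] at h1 h2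
    obtain ⟨r, hr⟩ := (pow_dvd_pow υ hbi).trans h1
    obtain ⟨s, hs⟩ := h2
    refine ⟨s - r, ?_⟩
    have hb : υ ^ b = υ ^ (i - a) * υ ^ c := by
      rw [← pow_add]
      congr 1
      lia
    linear_combination υ ^ (i - a) * hs - hr - s * hb

/-- Over the self-injective ring `k[u]/(u ^ n)`, multiplication by `u ^ (j - 1)` on `W j`, with
`2 * j ≤ n`, does not factor through a projective module: an element killed by `u ^ j` in a
projective module is a multiple of `u ^ (n - j)`, and `u ^ (n - j)` kills `W j`. -/
theorem not_factor_through_projective {j : ℕ} (hj : 1 ≤ j) (hjn : 2 * j ≤ n) {P : Type*}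
    [AddCommGroup P] [Module S P] [Module.Projective S P] (f : W j →ₗ[S] P) (g : P →ₗ[S] W j) :
    g ∘ₗ f ≠ υ ^ (j - 1) • LinearMap.id := by
  intro hfg
  -- `s` embeds `P` into a free module, where divisibility is seen on coordinates
  obtain ⟨s, hs⟩ := Module.projective_def'.1 (inferInstance : Module.Projective S P)
  classical
  have h1 : υ ^ j • s (f (Submodule.Quotient.mk 1)) = 0 := by
    rw [← map_smul, ← map_smul, u_pow_smul_uniserial le_rfl, map_zero, map_zero]
  choose! c hc using fun p => u_pow_dvd_of_mul_eq_zero (k := k) (n := n) (d := j) (by lia)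
    (x := s (f (Submodule.Quotient.mk 1)) p) (by simpa using DFunLike.congr_fun h1 p)
  have h2 : ∃ y : P →₀ S, s (f (Submodule.Quotient.mk 1)) = υ ^ (n - j) • y := by
    refine ⟨Finsupp.onFinset (s (f (Submodule.Quotient.mk 1))).support
      (fun p => if s (f (Submodule.Quotient.mk 1)) p = 0 then 0 else c p) (fun p hp => ?_), ?_⟩
    · rw [Finsupp.mem_support_iff]
      exact fun h => hp (if_pos h)
    · ext p
      rw [Finsupp.smul_apply, Finsupp.onFinset_apply, smul_eq_mul]
      split_ifs with h
      · rw [h, mul_zero]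
      · exact hc p
  obtain ⟨y, hy⟩ := h2
  have h3 : f (Submodule.Quotient.mk 1) = υ ^ (n - j) • Finsupp.linearCombination S id y := by
    rw [← map_smul, ← hy]
    exact (LinearMap.congr_fun hs _).symm
  have h4 : υ ^ (j - 1) • (Submodule.Quotient.mk 1 : W j) = 0 := by
    have := LinearMap.congr_fun hfg (Submodule.Quotient.mk 1)
    change g (f _) = υ ^ (j - 1) • Submodule.Quotient.mk 1 at this
    rw [← this, h3, map_smul, u_pow_smul_uniserial (by lia)]
  rw [← Submodule.Quotient.mk_smul, uniserial_mk_eq_zero_iff, smul_eq_mul, mul_one,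
    u_pow_dvd_u_pow_iff (by lia)] at h4
  lia

/-- As a `k[u]`-module, `W j` is `k[u]/(u ^ j)`. -/
def polyQuotEquiv {j : ℕ} (hj : j ≤ n) :
    (k[X] ⧸ Submodule.span k[X] {(Polynomial.X : k[X]) ^ j}) ≃ₗ[k[X]] W j :=
  let φ : k[X] →ₗ[k[X]] W j :=
    ((Ideal.span {υ ^ j}).mkQ.restrictScalars k[X]).comp
      (Algebra.linearMap k[X] S)
  (Submodule.quotEquivOfEq _ (LinearMap.ker φ) (by
    ext p
    rw [LinearMap.mem_ker, Ideal.submodule_span_eq, Ideal.mem_span_singleton]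
    exact (u_pow_dvd_mk_iff hj).symm.trans uniserial_mk_eq_zero_iff.symm)).trans
  (φ.quotKerEquivOfSurjective
    ((Submodule.mkQ_surjective _).comp Ideal.Quotient.mk_surjective))

/-- The structure theorem over `k[u]`, for modules killed by `u ^ n`. -/
theorem exists_equiv_pi_uniserial (M : Type u) [AddCommGroup M] [Module S M] [Module.Finite S M] :
    ∃ (d : ℕ) (e : Fin d → ℕ), (∀ i, e i ≤ n) ∧ Nonempty (M ≃ₗ[S] ∀ i, W (e i)) := by
  let : Module k[X] M := Module.compHom M (algebraMap k[X] S)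
  have : IsScalarTower k[X] S M := ⟨fun r s x => mul_smul (algebraMap k[X] S r) s x⟩
  have hsurj : Function.Surjective (algebraMap k[X] S) := Ideal.Quotient.mk_surjective
  have : Module.Finite k[X] S := Module.Finite.of_surjective (Algebra.linearMap k[X] S) hsurj
  have : Module.Finite k[X] M := Module.Finite.trans S M
  have hX : ∀ x : M, (Polynomial.X ^ n : k[X]) • x = 0 := fun x =>
    (congrArg (· • x) (mk_eq_zero_iff.2 dvd_rfl :
      Ideal.Quotient.mk _ (Polynomial.X ^ n) = (0 : S))).trans (zero_smul S x)
  obtain ⟨d, e, ⟨φ⟩⟩ := Module.torsion_by_prime_power_decomposition (R := k[X]) (M := M)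
    Polynomial.irreducible_X ((Submodule.isTorsion'_powers_iff _).2 fun x => ⟨n, hX x⟩)
  have he : ∀ i, e i ≤ n := fun i => by
    have h1 := congrArg φ (hX (φ.symm (DirectSum.lof k[X] (Fin d)
      (fun i => k[X] ⧸ Submodule.span k[X] {(Polynomial.X : k[X]) ^ e i}) i
      (Submodule.Quotient.mk 1))))
    rw [map_smul, LinearEquiv.apply_symm_apply, map_zero, ← map_smul] at h1
    have h2 := congrArg (fun z => z i) h1
    simp only [DirectSum.lof_apply, DirectSum.zero_apply] at h2
    rw [← Submodule.Quotient.mk_smul, Submodule.Quotient.mk_eq_zero, Ideal.submodule_span_eq,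
      Ideal.mem_span_singleton, smul_eq_mul, mul_one] at h2
    exact (pow_dvd_pow_iff Polynomial.X_ne_zero Polynomial.not_isUnit_X).1 h2
  -- a `k[u]`-linear map is linear over the quotient ring
  refine ⟨d, e, he, ⟨LinearEquiv.extendScalarsOfSurjective hsurj ?_⟩⟩
  exact φ.trans ((DirectSum.linearEquivFunOnFintype _ _ _).trans
    (LinearEquiv.piCongrRight fun i => polyQuotEquiv (he i)))

end TruncPoly

end TruncatedAlgebra

/-! ### Objects of the category of singularities -/

noncomputable section SingularityCategory

variable (S : Type u) [CommRing S] [IsNoetherianRing S]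
  [HasDerivedCategory.{w} (FGModuleCat.{u} S)]

instance (n : ℤ) : (shiftFunctor (Db.{w} S) n).Linear S where
  map_smul {X Y} f r := by
    have : (shiftFunctor (Db.{w} S) n ⋙ DerivedCategory.Bounded.ι).Linear S :=
      Functor.linear_of_iso _ (DerivedCategory.Bounded.ι.commShiftIso n).symm
    exact DerivedCategory.Bounded.ι.map_injective
      ((shiftFunctor (Db.{w} S) n ⋙ DerivedCategory.Bounded.ι).map_smul r f)

instance (n : ℤ) : (shiftFunctor (Dsg.{w} S) n).Linear S :=
  Shift.linear_of_localization S (perf.{w} S).trW.Q (perf.{w} S).trW _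

/-- Finitely generated modules inside `Db S`, functorially. -/
def moduleToDbFunctor : FGModuleCat.{u} S ⥤ Db.{w} S :=
  ObjectProperty.lift _ (DerivedCategory.singleFunctor (FGModuleCat.{u} S) 0)
    fun M => (moduleToDb.{w} S M).property

instance : (moduleToDbFunctor.{w} S).Linear S where
  map_smul {M N} f r := by
    apply DerivedCategory.Bounded.ι.map_injective
    exact (DerivedCategory.singleFunctor (FGModuleCat.{u} S) 0).map_smul r f

instance : (moduleToDbFunctor.{w} S).Additive where
  map_add {M N f g} := by
    apply DerivedCategory.Bounded.ι.map_injective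
    exact (DerivedCategory.singleFunctor (FGModuleCat.{u} S) 0).map_add

/-- The functor from finitely generated modules to the category of singularities that is
`moduleToDsg` on objects. -/
def moduleToDsgFunctor : FGModuleCat.{u} S ⥤ Dsg.{w} S :=
  moduleToDbFunctor S ⋙ (perf.{w} S).trW.Q

instance : (moduleToDsgFunctor.{w} S).Linear S where
  map_smul f r := by
    change (perf.{w} S).trW.Q.map _ = _
    rw [Functor.map_smul, Functor.map_smul]
    rfl

instance : (moduleToDsgFunctor.{w} S).Additive := by
  unfold moduleToDsgFunctor
  infer_instance

variable {S}

/-- A short exact sequence of modules gives a distinguished triangle. -/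
theorem exists_distTriang_moduleToDsg {E : ShortComplex (FGModuleCat.{u} S)} (hE : E.ShortExact) :
    ∃ δ : (moduleToDsgFunctor.{w} S).obj E.X₃ ⟶ ((moduleToDsgFunctor.{w} S).obj E.X₁)⟦(1 : ℤ)⟧,
      Triangle.mk ((moduleToDsgFunctor.{w} S).map E.f) ((moduleToDsgFunctor.{w} S).map E.g) δ ∈
        distTriang (Dsg.{w} S) := by
  let δ' : (moduleToDbFunctor.{w} S).obj E.X₃ ⟶ ((moduleToDbFunctor.{w} S).obj E.X₁)⟦(1 : ℤ)⟧ :=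
    DerivedCategory.TStructure.t.bounded.fullyFaithfulι.preimage
      (hE.singleδ ≫ (DerivedCategory.Bounded.ι.commShiftIso (1 : ℤ)).inv.app
        ((moduleToDbFunctor.{w} S).obj E.X₁))
  have h : Triangle.mk ((moduleToDbFunctor.{w} S).map E.f) ((moduleToDbFunctor.{w} S).map E.g) δ' ∈
      distTriang (Db.{w} S) := by
    change DerivedCategory.Bounded.ι.mapTriangle.obj _ ∈ distTriang _
    refine isomorphic_distinguished _ hE.singleTriangle_distinguished _
      (Triangle.isoMk _ _ (Iso.refl _) (Iso.refl _) (Iso.refl _) ?_ ?_ ?_)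
    · exact (Category.comp_id _).trans (Category.id_comp _).symm
    · exact (Category.comp_id _).trans (Category.id_comp _).symm
    · have hδ : DerivedCategory.Bounded.ι.map δ' ≫
          (DerivedCategory.Bounded.ι.commShiftIso (1 : ℤ)).hom.app _ = hE.singleδ := by
        rw [Functor.FullyFaithful.map_preimage]
        exact (Category.assoc _ _ _).trans ((congrArg (hE.singleδ ≫ ·)
          (Iso.inv_hom_id_app (DerivedCategory.Bounded.ι.commShiftIso (1 : ℤ))
            ((moduleToDbFunctor.{w} S).obj E.X₁))).trans (Category.comp_id _))
      exact (congrArg (_ ≫ ·) (CategoryTheory.Functor.map_id _ _)).trans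
        ((Category.comp_id _).trans (hδ.trans (Category.id_comp _).symm))
  exact ⟨_, (perf.{w} S).trW.Q.map_distinguished _ h⟩

theorem isZero_of_perf {X : Db.{w} S} (hX : perf.{w} S X) : IsZero ((perf.{w} S).trW.Q.obj X) := by
  have h : (perf.{w} S).trW (0 : (0 : Db.{w} S) ⟶ X) :=
    ObjectProperty.trW.mk _ (T := Triangle.mk (0 : (0 : Db.{w} S) ⟶ X) (𝟙 X) 0)
      (contractible_distinguished₁ X) hX
  have := Localization.inverts (perf.{w} S).trW.Q _ _ h
  exact ((Functor.map_isZero _ (isZero_zero _))).of_iso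
    (asIso ((perf.{w} S).trW.Q.map (0 : (0 : Db.{w} S) ⟶ X))).symm

theorem perfectComplexes_single (P : FGModuleCat.{u} S) [Projective P] (b : ℤ) :
    perfectComplexes.{w} S ((DerivedCategory.singleFunctor (FGModuleCat.{u} S) b).obj P) := by
  refine ⟨(CochainComplex.singleFunctor (FGModuleCat.{u} S) b).obj P,
    ⟨⟨b, inferInstance⟩, ⟨b, inferInstance⟩, fun i => ?_⟩, ⟨Iso.refl _⟩⟩
  rw [← projective_iff]
  by_cases h : i = b
  · subst h
    exact Projective.of_iso (HomologicalComplex.singleObjXSelf (.up ℤ) i P).symm inferInstance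
  · exact Projective.of_iso
      (HomologicalComplex.isZero_single_obj_X (.up ℤ) b P i h).isoZero.symm inferInstance

theorem isZero_moduleToDsg (P : FGModuleCat.{u} S) [Projective P] :
    IsZero ((moduleToDsgFunctor.{w} S).obj P) :=
  isZero_of_perf (perfectComplexes_single P 0)

instance : EnoughProjectives (FGModuleCat.{u} S) where
  presentation M := by
    obtain ⟨n, f, hf⟩ := Module.Finite.exists_fin' S M
    let g : FGModuleCat.of S (Fin n → S) ⟶ M := FGModuleCat.ofHom (W := M) f
    have : Projective (FGModuleCat.of S (Fin n → S)) :=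
      (projective_iff _).2 (inferInstanceAs (Module.Projective S (Fin n → S)))
    have : Epi g := ConcreteCategory.epi_of_surjective g hf
    exact ⟨⟨_, g⟩⟩

/-- In the top degree `b` of `K` and `L`, cohomology is a quotient of the terms `K.X b` and
`L.X b`. -/
theorem epi_homologyMap_of_epi {C : Type*} [Category C] [Abelian C] {K L : CochainComplex C ℤ}
    (φ : K ⟶ L) (b : ℤ) [Epi (φ.f b)] [K.IsStrictlyLE b] [L.IsStrictlyLE b] :
    Epi (HomologicalComplex.homologyMap φ b) := by
  have hK : K.d b (b + 1) = 0 := (K.isZero_of_isStrictlyLE b _ (by lia)).eq_of_tgt _ _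
  have hL : L.d b (b + 1) = 0 := (L.isZero_of_isStrictlyLE b _ (by lia)).eq_of_tgt _ _
  have := K.isIso_iCycles b (b + 1) (by simp) hK
  have := L.isIso_iCycles b (b + 1) (by simp) hL
  have : Epi (HomologicalComplex.cyclesMap φ b) := by
    have h : HomologicalComplex.cyclesMap φ b = K.iCycles b ≫ φ.f b ≫ inv (L.iCycles b) := by
      rw [← cancel_mono (L.iCycles b)]
      simp
    rw [h]
    infer_instance
  have h : K.homologyπ b ≫ HomologicalComplex.homologyMap φ b =
    HomologicalComplex.cyclesMap φ b ≫ L.homologyπ b := by simp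
  have : Epi (K.homologyπ b ≫ HomologicalComplex.homologyMap φ b) := by
    rw [h]
    infer_instance
  exact epi_of_epi (K.homologyπ b) _

theorem epi_homologyFunctor_map_of_epi {C : Type*} [Category C] [Abelian C]
    [HasDerivedCategory C] {K L : CochainComplex C ℤ} (φ : K ⟶ L) (b : ℤ) [Epi (φ.f b)]
    [K.IsStrictlyLE b] [L.IsStrictlyLE b] :
    Epi ((DerivedCategory.homologyFunctor C b).map (DerivedCategory.Q.map φ)) := by
  have := epi_homologyMap_of_epi φ b
  have h := DerivedCategory.homologyFunctorFactors_hom_naturality φ b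
  have h' : Epi ((DerivedCategory.homologyFunctor C b).map (DerivedCategory.Q.map φ) ≫
      (DerivedCategory.homologyFunctorFactors C b).hom.app L) := by
    rw [h]
    exact epi_comp' inferInstance this
  exact (MorphismProperty.cancel_right_of_respectsIso (MorphismProperty.epimorphisms C) _
    ((DerivedCategory.homologyFunctorFactors C b).hom.app L)).1 h'

/-- A complex with cohomology in `[a, b]` is isomorphic, up to perfect complexes, to one with
cohomology in `[a, b - 1]`: cover its top cohomology by a projective module and take the cone. -/
theorem exists_iso_isLE (X : Db.{w} S) (a b c : ℤ) (hb : b + 1 = c) (hab : a ≤ b) [X.obj.IsGE a]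
    [X.obj.IsLE c] : ∃ Y : Db.{w} S, Y.obj.IsGE a ∧ Y.obj.IsLE b ∧
      Nonempty ((perf.{w} S).trW.Q.obj X ≅ (perf.{w} S).trW.Q.obj Y) := by
  obtain ⟨K, _, _, ⟨e⟩⟩ := X.obj.exists_iso_Q_obj_of_isGE_of_isLE a c
  let p := Projective.π (K.X c)
  let φ : (CochainComplex.singleFunctor (FGModuleCat.{u} S) c).obj (Projective.over (K.X c)) ⟶ K :=
    HomologicalComplex.mkHomFromSingle p (fun i hi => by
      obtain rfl : c + 1 = i := hi
      exact (K.isZero_of_isStrictlyLE c _ (by lia)).eq_of_tgt _ _)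
  let P : Db.{w} S := ⟨(DerivedCategory.singleFunctor (FGModuleCat.{u} S) c).obj
    (Projective.over (K.X c)), ⟨c, inferInstance⟩, ⟨c, inferInstance⟩⟩
  let g : P ⟶ X := DerivedCategory.TStructure.t.bounded.fullyFaithfulι.preimage
    (DerivedCategory.Q.map φ ≫ e.inv)
  obtain ⟨Y, g', h, hT⟩ := distinguished_cocone_triangle g
  have hT' := DerivedCategory.Bounded.ι.map_distinguished _ hT
  have hepi : Epi ((DerivedCategory.homologyFunctor _ c).map
      (DerivedCategory.Bounded.ι.mapTriangle.obj (Triangle.mk g g' h)).mor₁) := by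
    have : Epi (φ.f c) := by
      change Epi ((HomologicalComplex.mkHomFromSingle p _).f c)
      rw [HomologicalComplex.mkHomFromSingle_f]
      exact epi_comp _ _
    have := epi_homologyFunctor_map_of_epi φ c
    change Epi ((DerivedCategory.homologyFunctor _ c).map (DerivedCategory.Q.map φ ≫ e.inv))
    rw [Functor.map_comp]
    exact epi_comp _ _
  have hP : ∀ i, i ≠ c → IsZero ((DerivedCategory.homologyFunctor _ i).obj P.obj) := fun i hi => by
    rcases lt_or_gt_of_ne hi with h | h
    · exact DerivedCategory.isZero_of_isGE ((DerivedCategory.singleFunctor _ c).obj _) c i h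
    · exact DerivedCategory.isZero_of_isLE ((DerivedCategory.singleFunctor _ c).obj _) c i h
  have hY : ∀ i, IsZero ((DerivedCategory.homologyFunctor _ i).obj X.obj) → i + 1 ≠ c →
      IsZero ((DerivedCategory.homologyFunctor _ i).obj Y.obj) := fun i hi hic =>
    (DerivedCategory.HomologySequence.exact₃ _ hT' i (i + 1)).isZero_of_both_zeros
      (hi.eq_of_src _ _) ((hP _ hic).eq_of_tgt _ _)
  refine ⟨Y, ?_, ?_, ⟨?_⟩⟩
  · rw [DerivedCategory.isGE_iff]
    exact fun i hi => hY i (X.obj.isZero_of_isGE a i hi) (by lia)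
  · rw [DerivedCategory.isLE_iff]
    intro i hi
    rcases (show c ≤ i by lia).eq_or_lt with rfl | hi
    · exact (DerivedCategory.HomologySequence.exact₃ _ hT' c (c + 1)).isZero_of_both_zeros
        ((DerivedCategory.HomologySequence.epi_homologyMap_mor₁_iff _ hT' c).1 hepi)
        ((hP _ (by lia)).eq_of_tgt _ _)
    · exact hY i (X.obj.isZero_of_isLE c i hi) (by lia)
  · have : IsIso ((perf.{w} S).trW.Q.map g') := Localization.inverts _ _ _ (ObjectProperty.trW.mk' _ hT
      (show perf.{w} S P from perfectComplexes_single (Projective.over (K.X c)) c))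
    exact asIso ((perf.{w} S).trW.Q.map g')

/-- A complex with cohomology in `[a, a + d]` becomes isomorphic to a module in degree `a`. -/
theorem exists_iso_shift_of_isGE_of_isLE (d : ℕ) (a : ℤ) (X : Db.{w} S) [X.obj.IsGE a]
    [hX : X.obj.IsLE (a + d)] : ∃ M : FGModuleCat.{u} S,
      Nonempty ((perf.{w} S).trW.Q.obj X ≅ ((moduleToDsgFunctor.{w} S).obj M)⟦-a⟧) := by
  induction d generalizing X with
  | zero =>
    rw [Nat.cast_zero, add_zero] at hX
    obtain ⟨M, ⟨e⟩⟩ := X.obj.exists_iso_singleFunctor_obj_of_isGE_of_isLE a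
    let e' : X ≅ ((moduleToDbFunctor.{w} S).obj M)⟦-a⟧ :=
      DerivedCategory.TStructure.t.bounded.fullyFaithfulι.preimageIso
        (e ≪≫ (((DerivedCategory.singleFunctors (FGModuleCat.{u} S)).shiftIso (-a) a 0
          (by lia)).app M).symm ≪≫ (DerivedCategory.Bounded.ι.commShiftIso (-a)).symm.app
            ((moduleToDbFunctor.{w} S).obj M))
    exact ⟨M, ⟨(perf.{w} S).trW.Q.mapIso e' ≪≫
      ((perf.{w} S).trW.Q.commShiftIso (-a)).app ((moduleToDbFunctor.{w} S).obj M)⟩⟩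
  | succ d ih =>
    obtain ⟨Y, _, _, ⟨e⟩⟩ := exists_iso_isLE X a (a + d) (a + (d + 1 : ℕ)) (by push_cast; ring)
      (by lia)
    obtain ⟨M, ⟨e'⟩⟩ := ih Y
    exact ⟨M, ⟨e ≪≫ e'⟩⟩

/-- Every object of the category of singularities is a shift of a module. -/
theorem exists_iso_shift_moduleToDsg (X : Dsg.{w} S) : ∃ (M : FGModuleCat.{u} S) (a : ℤ),
    Nonempty (X ≅ ((moduleToDsgFunctor.{w} S).obj M)⟦a⟧) := by
  have := Localization.essSurj (perf.{w} S).trW.Q (perf.{w} S).trW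
  let e := (perf.{w} S).trW.Q.objObjPreimageIso X
  obtain ⟨⟨a, ha⟩, ⟨b, hb⟩⟩ := ((perf.{w} S).trW.Q.objPreimage X).property
  have hb' : ((perf.{w} S).trW.Q.objPreimage X).obj.IsLE (a + (b - a).toNat) :=
    DerivedCategory.TStructure.t.isLE_of_le _ b _ (by lia)
  obtain ⟨M, ⟨e'⟩⟩ := exists_iso_shift_of_isGE_of_isLE (b - a).toNat a
    ((perf.{w} S).trW.Q.objPreimage X)
  exact ⟨M, -a, ⟨e.symm ≪≫ e'⟩⟩

end SingularityCategory

/-! ### Morphisms of modules that vanish in the category of singularities -/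

section Factorization

section

variable {C : Type*} [Category C] [Abelian C] [HasDerivedCategory C]

theorem exists_Q_map_eq_of_isKInjective {K L : CochainComplex C ℤ} [L.IsKInjective]
    (φ : DerivedCategory.Q.obj K ⟶ DerivedCategory.Q.obj L) :
    ∃ f : K ⟶ L, DerivedCategory.Q.map f = φ := by
  let i := DerivedCategory.quotientCompQhIso C
  obtain ⟨g, hg⟩ := (CochainComplex.IsKInjective.Qh_map_bijective
    ((HomotopyCategory.quotient _ _).obj K) L).surjective (i.hom.app K ≫ φ ≫ i.inv.app L)
  obtain ⟨f, rfl⟩ := (HomotopyCategory.quotient _ _).map_surjective g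
  refine ⟨f, ?_⟩
  rw [← cancel_epi (i.hom.app K), ← DerivedCategory.quotientCompQhIso_hom_naturality f, hg]
  simp [i]

theorem exists_Q_map_eq_of_isKProjective {K L : CochainComplex C ℤ} [K.IsKProjective]
    (φ : DerivedCategory.Q.obj K ⟶ DerivedCategory.Q.obj L) :
    ∃ f : K ⟶ L, DerivedCategory.Q.map f = φ := by
  let i := DerivedCategory.quotientCompQhIso C
  obtain ⟨g, hg⟩ := (CochainComplex.IsKProjective.Qh_map_bijective K
    ((HomotopyCategory.quotient _ _).obj L)).surjective (i.hom.app K ≫ φ ≫ i.inv.app L)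
  obtain ⟨f, rfl⟩ := (HomotopyCategory.quotient _ _).map_surjective g
  refine ⟨f, ?_⟩
  rw [← cancel_epi (i.hom.app K), ← DerivedCategory.quotientCompQhIso_hom_naturality f, hg]
  simp [i]

/-- A morphism of modules that factors, in the derived category, through a bounded complex `K` of
objects which are both projective and injective factors through `K.X 0`: both halves of the
factorization are then given by morphisms of complexes. -/
theorem exists_factor_of_Q {K : CochainComplex C ℤ} (a b : ℤ) [K.IsStrictlyGE a] [K.IsStrictlyLE b]
    [∀ i, Projective (K.X i)] [∀ i, Injective (K.X i)] {M N : C} {f : M ⟶ N}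
    (α : (DerivedCategory.singleFunctor C 0).obj M ⟶ DerivedCategory.Q.obj K)
    (β : DerivedCategory.Q.obj K ⟶ (DerivedCategory.singleFunctor C 0).obj N)
    (h : (DerivedCategory.singleFunctor C 0).map f = α ≫ β) :
    ∃ (g : M ⟶ K.X 0) (g' : K.X 0 ⟶ N), g ≫ g' = f := by
  have := CochainComplex.isKProjective_of_projective K b
  have := CochainComplex.isKInjective_of_injective K a
  obtain ⟨α', hα⟩ := exists_Q_map_eq_of_isKInjective
    (K := (HomologicalComplex.single C (.up ℤ) 0).obj M) α
  obtain ⟨β', hβ⟩ := exists_Q_map_eq_of_isKProjective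
    (L := (HomologicalComplex.single C (.up ℤ) 0).obj N) β
  obtain ⟨γ, hγ⟩ := (HomologicalComplex.single C (.up ℤ) 0).map_surjective (α' ≫ β')
  have hγf : γ = f := by
    apply (DerivedCategory.singleFunctor C 0).map_injective
    rw [h, ← hα, ← hβ]
    change DerivedCategory.Q.map ((HomologicalComplex.single C (.up ℤ) 0).map γ) = _
    rw [hγ, Functor.map_comp]
    rfl
  refine ⟨(HomologicalComplex.singleObjXSelf (.up ℤ) 0 M).inv ≫ α'.f 0,
    β'.f 0 ≫ (HomologicalComplex.singleObjXSelf (.up ℤ) 0 N).hom, ?_⟩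
  have h0 : ((HomologicalComplex.single C (.up ℤ) 0).map γ).f 0 = α'.f 0 ≫ β'.f 0 := by
    rw [hγ]
    rfl
  have h1 : ((HomologicalComplex.single C (.up ℤ) 0).map γ).f 0 =
      (HomologicalComplex.singleObjXSelf (.up ℤ) 0 M).hom ≫ γ ≫
        (HomologicalComplex.singleObjXSelf (.up ℤ) 0 N).inv :=
    HomologicalComplex.single_map_f_self _ _ _
  rw [Category.assoc, ← Category.assoc (α'.f 0), ← h0, h1, hγf]
  simp

end

/-- A finitely generated projective module is a summand of some `S ^ n`. -/
theorem injective_of_baer {S : Type u} [CommRing S] [IsNoetherianRing S]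
    (hS : Module.Baer S S) (P : FGModuleCat.{u} S) (hP : Projective P) : Injective P := by
  obtain ⟨n, f, hf⟩ := Module.Finite.exists_fin' S P
  rw [projective_iff] at hP
  obtain ⟨s, hs⟩ := Module.projective_lifting_property f LinearMap.id hf
  refine ⟨fun {X Y} g i _ => ?_⟩
  have hi : Function.Injective i.hom.hom := by
    have : Mono ((forget₂ (FGModuleCat.{u} S) (ModuleCat.{u} S)).map i) := inferInstance
    rwa [ModuleCat.mono_iff_injective] at this
  choose l hl using fun j : Fin n => Module.Baer.extension_property hS i.hom.hom hi
    (LinearMap.proj j ∘ₗ s ∘ₗ g.hom.hom)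
  refine ⟨FGModuleCat.ofHom (f ∘ₗ LinearMap.pi l), FGModuleCat.hom_ext (LinearMap.ext fun x => ?_)⟩
  have h1 : LinearMap.pi l (i.hom.hom x) = s (g.hom.hom x) :=
    funext fun j => LinearMap.congr_fun (hl j) x
  change f (LinearMap.pi l (i.hom.hom x)) = g.hom.hom x
  rw [h1]
  exact LinearMap.congr_fun hs _

variable {S : Type u} [CommRing S] [IsNoetherianRing S]
  [HasDerivedCategory.{w} (FGModuleCat.{u} S)]

/-- Over a self-injective ring, the stable category of modules embeds in the category of
singularities: a morphism of modules that becomes zero factors through a projective module. -/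
theorem exists_factor_of_map_eq_zero
    (hS : ∀ P : FGModuleCat.{u} S, Projective P → Injective P) {M N : FGModuleCat.{u} S}
    (f : M ⟶ N) (hf : (moduleToDsgFunctor.{w} S).map f = 0) :
    ∃ (P : FGModuleCat.{u} S) (_ : Projective P) (g : M ⟶ P) (g' : P ⟶ N), g ≫ g' = f := by
  have hf' : (perf.{w} S).trW.Q.map ((moduleToDbFunctor.{w} S).map f) =
      (perf.{w} S).trW.Q.map 0 := by
    rw [Functor.map_zero]
    exact hf
  rw [MorphismProperty.map_eq_iff_postcomp (perf.{w} S).trW.Q (perf.{w} S).trW] at hf'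
  -- `f ≫ s = 0` for some `s` with a perfect cone, so `f` factors through the perfect fibre `X`
  obtain ⟨Z, s, hs, h⟩ := hf'
  rw [zero_comp] at h
  obtain ⟨X, t, p, hT, ⟨K, ⟨⟨a, _⟩, ⟨b, _⟩, hK⟩, ⟨e⟩⟩⟩ := (ObjectProperty.trW_iff' _ s).1 hs
  obtain ⟨φ, hφ⟩ : ∃ φ : _ ⟶ X, (moduleToDbFunctor.{w} S).map f = φ ≫ t :=
    Triangle.coyoneda_exact₂ _ hT _ h
  simp only [← projective_iff] at hK
  have hK' : ∀ i, Injective (K.X i) := fun i => hS _ (hK i)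
  obtain ⟨g, g', hg⟩ := exists_factor_of_Q a b (f := f)
    (DerivedCategory.Bounded.ι.map φ ≫ e.hom) (e.inv ≫ DerivedCategory.Bounded.ι.map t) (by
      have := (congrArg DerivedCategory.Bounded.ι.map hφ).trans (Functor.map_comp _ _ _)
      refine this.trans (Eq.symm ((Category.assoc _ _ _).trans ?_))
      exact congrArg (DerivedCategory.Bounded.ι.map φ ≫ ·)
        (Iso.hom_inv_id_assoc e (DerivedCategory.Bounded.ι.map t)))
  exact ⟨K.X 0, hK 0, g, g', hg⟩

end Factorization

/-! ### Direct sums and short exact sequences of finitely generated modules -/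

section Products

variable {R : Type u} [CommRing R] {D : Type*} [Category D] [Preadditive D]
  (F : FGModuleCat.{u} R ⥤ D) [F.Additive]

theorem nonempty_iso_biprod (M N : Type u) [AddCommGroup M] [Module R M] [Module.Finite R M]
    [AddCommGroup N] [Module R N] [Module.Finite R N] [HasBinaryBiproducts D] :
    Nonempty (F.obj (FGModuleCat.of R (M × N)) ≅
      F.obj (FGModuleCat.of R M) ⊞ F.obj (FGModuleCat.of R N)) := by
  let b : BinaryBicone (FGModuleCat.of R M) (FGModuleCat.of R N) :=
    { pt := FGModuleCat.of R (M × N)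
      fst := FGModuleCat.ofHom (LinearMap.fst R M N)
      snd := FGModuleCat.ofHom (LinearMap.snd R M N)
      inl := FGModuleCat.ofHom (LinearMap.inl R M N)
      inr := FGModuleCat.ofHom (LinearMap.inr R M N)
      inl_fst := rfl
      inl_snd := rfl
      inr_fst := rfl
      inr_snd := rfl }
  have hb : b.IsBilimit := isBinaryBilimitOfTotal b (FGModuleCat.hom_ext
    (LinearMap.ext fun x => Prod.ext (add_zero x.1) (zero_add x.2)))
  have := preservesBinaryBiproducts_of_preservesBiproducts F
  exact ⟨biprod.uniqueUpToIso _ _ (isBinaryBilimitOfPreserves F hb)⟩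

theorem nonempty_iso_biproduct {N : FGModuleCat.{u} R} {d : ℕ} {M : Fin d → Type u}
    [∀ i, AddCommGroup (M i)] [∀ i, Module R (M i)] [∀ i, Module.Finite R (M i)]
    [HasFiniteBiproducts D] (ψ : N ≃ₗ[R] ∀ i, M i) :
    Nonempty (F.obj N ≅ ⨁ fun i => F.obj (FGModuleCat.of R (M i))) := by
  classical
  let b : Bicone fun i => FGModuleCat.of R (M i) :=
    { pt := FGModuleCat.of R (∀ i, M i)
      π := fun i => FGModuleCat.ofHom (LinearMap.proj i)
      ι := fun i => FGModuleCat.ofHom (LinearMap.single R M i)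
      ι_π := fun i j => by
        split_ifs with h
        · subst h
          refine FGModuleCat.hom_ext (LinearMap.ext fun x => ?_)
          exact Pi.single_eq_same i x
        · refine FGModuleCat.hom_ext (LinearMap.ext fun x => ?_)
          exact Pi.single_eq_of_ne (Ne.symm h) x }
  have h (i : Fin d) : (∑ j, b.π j ≫ b.ι j) ≫ b.π i = b.π i := by
    rw [Preadditive.sum_comp, Finset.sum_eq_single i]
    · simp
    · intro j _ hj
      rw [Category.assoc, b.ι_π, dif_neg hj, comp_zero]
    · simp
  have hb : b.IsBilimit := isBilimitOfTotal b (FGModuleCat.hom_ext (LinearMap.ext fun x =>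
    funext fun i => congrArg (fun t => t.hom.hom x) (h i)))
  exact ⟨F.mapIso ψ.toFGModuleCatIso ≪≫ biproduct.uniqueUpToIso _ (isBilimitOfPreserves F hb)⟩

theorem fgModuleCat_shortExact [IsNoetherianRing R] {E : ShortComplex (FGModuleCat.{u} R)}
    (hf : Function.Injective E.f.hom.hom) (hfg : Function.Exact E.f.hom.hom E.g.hom.hom)
    (hg : Function.Surjective E.g.hom.hom) : E.ShortExact := by
  have hE : (E.map (forget₂ (FGModuleCat.{u} R) (ModuleCat.{u} R))).Exact := by
    rw [ShortComplex.ShortExact.moduleCat_exact_iff_function_exact]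
    exact hfg
  rw [ShortComplex.exact_map_iff_of_faithful] at hE
  have := ConcreteCategory.mono_of_injective E.f hf
  have := ConcreteCategory.epi_of_surjective E.g hg
  exact ⟨hE⟩

end Products

theorem distinguished_of_iso₂ {T : Type*} [Category T] [HasZeroObject T] [HasShift T ℤ]
    [Preadditive T] [∀ n : ℤ, (shiftFunctor T n).Additive] [Pretriangulated T] {X Y Y' Z : T}
    {f : X ⟶ Y} {g : Y ⟶ Z} {h : Z ⟶ X⟦(1 : ℤ)⟧} (hT : Triangle.mk f g h ∈ distTriang T)
    (e : Y ≅ Y') : Triangle.mk (f ≫ e.hom) (e.inv ≫ g) h ∈ distTriang T :=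
  isomorphic_distinguished _ hT _ (Triangle.isoMk _ _ (Iso.refl X) e.symm (Iso.refl Z)
    (by change (f ≫ e.hom) ≫ e.inv = 𝟙 X ≫ f; simp)
    (by change (e.inv ≫ g) ≫ 𝟙 Z = e.inv ≫ g; simp)
    (by change h ≫ (𝟙 X)⟦(1 : ℤ)⟧' = 𝟙 Z ≫ h; simp))

/-! ### The uniserial objects of the category of singularities of `k[u]/(u ^ n)` -/

section TruncPoly

variable (k : Type u) [Field k] (n : ℕ)
  [HasDerivedCategory.{w} (FGModuleCat.{u} (TruncPoly k n))]

open TruncPoly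

theorem isZero_V_zero : IsZero (V.{w} k n 0) := by
  have h : IsZero (FGModuleCat.of (TruncPoly k n) (Uniserial k n 0)) := by
    rw [IsZero.iff_id_eq_zero]
    refine FGModuleCat.hom_ext (LinearMap.ext fun x => ?_)
    exact (one_smul _ x).symm.trans
      ((congrArg (· • x) (pow_zero _).symm).trans (u_pow_smul_uniserial (i := 0) le_rfl x))
  exact (moduleToDsgFunctor.{w} (TruncPoly k n)).map_isZero h

theorem isZero_V_self : IsZero (V.{w} k n n) := by
  have h : Ideal.span {TruncPoly.u k n ^ n} = ⊥ := by
    rw [u_pow_self, Ideal.span_singleton_eq_bot]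
  have : Module.Projective (TruncPoly k n) (Uniserial k n n) :=
    Module.Projective.of_equiv (Submodule.quotEquivOfEqBot _ h).symm
  have : Projective (FGModuleCat.of (TruncPoly k n) (Uniserial k n n)) := (projective_iff _).2 this
  exact isZero_moduleToDsg _

theorem exists_distTriang_V {a b c i : ℕ} (h : a + b = i + c) (hca : c ≤ a) (hai : a ≤ i)
    (hbi : b ≤ i) (hin : i ≤ n) :
    ∃ (f : V.{w} k n a ⟶ V.{w} k n i ⊞ V.{w} k n c) (g : V.{w} k n i ⊞ V.{w} k n c ⟶ V.{w} k n b)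
      (p : V.{w} k n b ⟶ (V.{w} k n a)⟦(1 : ℤ)⟧),
      Triangle.mk f g p ∈ distTriang (Dsg.{w} (TruncPoly k n)) := by
  let E : ShortComplex (FGModuleCat.{u} (TruncPoly k n)) := ShortComplex.mk
    (FGModuleCat.ofHom (extensionInl (k := k) (n := n) hca hai))
    (FGModuleCat.ofHom (extensionSnd h hbi))
    (FGModuleCat.hom_ext (extension_exact h hca hai hbi).linearMap_comp_eq_zero)
  obtain ⟨δ, hδ⟩ := exists_distTriang_moduleToDsg.{w} (E := E)
    (fgModuleCat_shortExact (extensionInl_injective hca hai hin) (extension_exact h hca hai hbi)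
      (extensionSnd_surjective h hbi))
  obtain ⟨e⟩ := nonempty_iso_biprod (moduleToDsgFunctor.{w} (TruncPoly k n))
    (Uniserial k n i) (Uniserial k n c)
  exact ⟨_, _, δ, distinguished_of_iso₂ hδ e⟩

theorem exists_iso_shift_biproduct_V (X : Dsg.{w} (TruncPoly k n)) :
    ∃ (d : ℕ) (e : Fin d → ℕ) (a : ℤ), (∀ i, e i ≤ n) ∧
      Nonempty (X ≅ (⨁ fun i => V.{w} k n (e i))⟦a⟧) := by
  obtain ⟨M, a, ⟨φ⟩⟩ := exists_iso_shift_moduleToDsg X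
  obtain ⟨d, e, he, ⟨ψ⟩⟩ := exists_equiv_pi_uniserial (k := k) (n := n) M
  obtain ⟨θ⟩ := nonempty_iso_biproduct (moduleToDsgFunctor.{w} (TruncPoly k n)) (N := M)
    (M := fun i => Uniserial k n (e i)) ψ
  exact ⟨d, e, a, he, ⟨φ ≪≫ (shiftFunctor _ a).mapIso θ⟩⟩

theorem killedBy_V (j : ℕ) : killedBy (TruncPoly.u k n ^ j) (V.{w} k n j) := by
  change TruncPoly.u k n ^ j • 𝟙 ((moduleToDsgFunctor.{w} (TruncPoly k n)).obj
    (FGModuleCat.of (TruncPoly k n) (Uniserial k n j))) = 0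
  rw [← CategoryTheory.Functor.map_id, ← Functor.map_smul,
    show TruncPoly.u k n ^ j • 𝟙 (FGModuleCat.of (TruncPoly k n) (Uniserial k n j)) = 0 from
      FGModuleCat.hom_ext (LinearMap.ext fun x => u_pow_smul_uniserial le_rfl x),
    Functor.map_zero]

/-- If `u ^ (j - 1)` vanished on `V j` it would factor through a projective module already on
`k[u]/(u ^ j)`, because `k[u]/(u ^ n)` is self-injective. -/
theorem not_killedBy_V {j : ℕ} (hj : 1 ≤ j) (hjn : 2 * j ≤ n) :
    ¬ killedBy (TruncPoly.u k n ^ (j - 1)) (V.{w} k n j) := by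
  intro h
  change TruncPoly.u k n ^ (j - 1) • 𝟙 ((moduleToDsgFunctor.{w} (TruncPoly k n)).obj
    (FGModuleCat.of (TruncPoly k n) (Uniserial k n j))) = 0 at h
  rw [← CategoryTheory.Functor.map_id, ← Functor.map_smul] at h
  obtain ⟨P, hP, g, g', hg⟩ := exists_factor_of_map_eq_zero (injective_of_baer baer) _ h
  rw [projective_iff] at hP
  exact not_factor_through_projective hj hjn g.hom.hom g'.hom.hom
    (congrArg (fun t => t.hom.hom) hg)

theorem isUniserialSystem (hn : 2 ≤ n) : IsUniserialSystem (TruncPoly.u k n) n (V.{w} k n) where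
  isZero_bot := isZero_V_zero k n
  isZero_top := isZero_V_self k n
  exists_distTriang := exists_distTriang_V k n
  exists_iso_shift_biproduct := exists_iso_shift_biproduct_V k n
  killedBy_pow _ := killedBy_V k n _
  not_killedBy_pow := not_killedBy_V k n (by lia) (by lia)

end TruncPoly

end OrlovSpectrum

theorem mainTheorem2 (k : Type u) [Field k] (n : ℕ) (hn : 2 ≤ n)
    [HasDerivedCategory.{w} (FGModuleCat.{u} (TruncPoly k n))] :
    orlovSpectrum (Dsg.{w} (TruncPoly k n)) =
        {t : ℕ | ∃ s : ℕ, 1 ≤ s ∧ (t : ℤ) = ⌈((n / 2 : ℕ) : ℚ) / (s : ℚ)⌉ - 1} ∧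
      (∀ G : Dsg.{w} (TruncPoly k n), IsGenerator G →
        ∃ δ : ℕ, 1 ≤ δ ∧ IsGreatest {j : ℕ | j ≤ n / 2 ∧ level G 0 (V.{w} k n j)} δ ∧
          (level G 0 = ⊤ → generationTime G = 0) ∧
          (level G 0 ≠ ⊤ → ∃ t : ℕ, generationTime G = (t : ℕ∞) ∧
            (t : ℤ) = max (⌈((n / 2 : ℕ) : ℚ) / (δ : ℚ)⌉ - 1) 1)) ∧
      ((∃ s : ℕ, 1 ≤ s ∧ HasGap (orlovSpectrum (Dsg.{w} (TruncPoly k n))) s) ↔ 8 ≤ n) := by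
  have hV := isUniserialSystem.{w} k n hn
  have h := hV.orlovSpectrum_eq hn
  exact ⟨h, fun G hG => hV.exists_isGreatest hn hG,
    (exists_hasGap_iff (m := n / 2) (by lia) h).trans (by lia)⟩
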